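/- For $b>0$ let $\mathcal K_b=\mathbb R^2/\!\sim$ be the flat Klein bottle, where $\sim$ is the equivalence relation generated by $(x_1,x_2)\sim(1+x_1,x_2)$ and $(x_1,x_2)\sim(1-x_1,b+x_2)$, with the flat Riemannian metric inherited from $\mathbb R^2$. A heat kernel on $\mathcal K_b$ is a fundamental solution of the heat equation $\partial_t u=\Delta u$ on $\mathcal K_b$: a real-valued function $K_t(x,y)$, $t>0$, $x,y\in\mathcal K_b$, such that for every $x$ the function $(t,y)\mapsto K_t(x,y)$ is smooth on $(0,\infty)\times\mathcal K_b$ and satisfies $\partial_tK_t(x,y)=\Delta_yK_t(x,y)$, and $\int_{\mathcal K_b}K_t(x,y)f(y)\,d\mathrm{vol}(y)\to f(x)$ as $t\to0^+$ for every continuous $f:\mathcal K_b\to\mathbb R$. A function $G:\mathcal K_b\times\mathcal K_b\to\mathbb R$ is geodesically decreasing if, for every $x\in\mathcal K_b$ and every minimal geodesic $\gamma:[0,s_0]\to\mathcal K_b$ (a geodesic whose length equals the distance between its endpoints) with $\gamma(0)=x$, the function $s\mapsto G(x,\gamma(s))$ is non-increasing on $[0,s_0]$. Proposition. Let $b>0$.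 Then $\mathcal K_b$ has a heat kernel $K_t(x,y)$, and for every such kernel there is $T>0$ such that, for all $t\ge T$, the function $K_t$ is not geodesically decreasing. -/

import Mathlib

/-- The Euclidean plane. -/
abbrev Plane : Type := EuclideanSpace ℝ (Fin 2)

/-- The gluing relation `(x₁, x₂) ~ (1 + x₁, x₂)` and `(x₁, x₂) ~ (1 - x₁, b + x₂)`. -/
inductive KleinRel (b : ℝ) : Plane → Plane → Prop
  | translate (x : Plane) : KleinRel b x (!₂[1 + x 0, x 1])
  | glide (x : Plane) : KleinRel b x (!₂[1 - x 0, b + x 1])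

/-- The flat Klein bottle of height `b`: the quotient of the plane by the equivalence relation
generated by `KleinRel b`. -/
def KleinBottle (b : ℝ) : Type := Quot (KleinRel b)

namespace KleinBottle

/-- The quotient topology. -/
instance (b : ℝ) : TopologicalSpace (KleinBottle b) :=
  inferInstanceAs (TopologicalSpace (Quot (KleinRel b)))

/-- The quotient σ-algebra. -/
instance (b : ℝ) : MeasurableSpace (KleinBottle b) :=
  inferInstanceAs (MeasurableSpace (Quot (KleinRel b)))

/-- The quotient map from the plane; for `b > 0` it is the universal covering, and it is a local
isometry for the flat metric of the Klein bottle. -/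
def proj (b : ℝ) (p : Plane) : KleinBottle b := Quot.mk (KleinRel b) p

/-- The distance of the flat metric: the least length of a curve joining `x` to `y`. Since curves
lift to the plane with the same length, it is the infimum of the Euclidean distances between the
points over `x` and the points over `y`. -/
noncomputable def gdist {b : ℝ} (x y : KleinBottle b) : ℝ :=
  sInf {r : ℝ | ∃ p q : Plane, proj b p = x ∧ proj b q = y ∧ r = dist p q}

/-- The Riemannian volume: Lebesgue measure on the fundamental rectangle `[0,1) × [0,b)`,
transported by the quotient map. -/
noncomputable def vol (b : ℝ) : MeasureTheory.Measure (KleinBottle b) :=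
  (MeasureTheory.volume.restrict
    {p : Plane | p 0 ∈ Set.Ico (0 : ℝ) 1 ∧ p 1 ∈ Set.Ico (0 : ℝ) b}).map (proj b)

/-- `γ : [0,s₀] → KleinBottle b` is a minimal geodesic: a geodesic, i.e. the image under the
quotient map of a straight line segment with constant velocity `v`, whose length `s₀ ‖v‖` equals
the distance of its endpoints. The values of `γ` outside `[0,s₀]` play no role. -/
def IsMinimalGeodesic {b : ℝ} (γ : ℝ → KleinBottle b) (s₀ : ℝ) : Prop :=
  0 ≤ s₀ ∧ ∃ p v : Plane, (∀ s ∈ Set.Icc 0 s₀, γ s = proj b (p + s • v)) ∧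
    s₀ * ‖v‖ = gdist (γ 0) (γ s₀)

/-- `F` decreases geodesically about `x`: it is non-increasing along every minimal geodesic
starting at `x`. -/
def DecreasesGeodesicallyAbout {b : ℝ} (F : KleinBottle b → ℝ) (x : KleinBottle b) : Prop :=
  ∀ (s₀ : ℝ) (γ : ℝ → KleinBottle b), IsMinimalGeodesic γ s₀ → γ 0 = x →
    AntitoneOn (fun s => F (γ s)) (Set.Icc 0 s₀)

/-- `G` is geodesically decreasing: `G x ·` decreases geodesically about `x`, for every `x`. -/
def GeodesicallyDecreasing {b : ℝ} (G : KleinBottle b → KleinBottle b → ℝ) : Prop :=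
  ∀ x : KleinBottle b, DecreasesGeodesicallyAbout (G x) x

/-- `K t x y`, for `t > 0`, is the heat kernel of the Klein bottle, i.e. the fundamental solution
of the heat equation `∂ₜ u = Δ u`: for every `x`, the function `(t, y) ↦ K t x y` is a smooth
solution for `t > 0` which tends to the unit point mass at `x` as `t → 0+`. Smoothness and the
Laplace-Beltrami operator of the flat metric are read off on the universal covering. The values of
`K` for `t ≤ 0` play no role. -/
structure IsHeatKernel (b : ℝ) (K : ℝ → KleinBottle b → KleinBottle b → ℝ) : Prop where
  smooth : ∀ x : KleinBottle b,
    ContDiffOn ℝ (⊤ : ℕ∞) (fun z : ℝ × Plane => K z.1 x (proj b z.2))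
      (Set.Ioi (0 : ℝ) ×ˢ (Set.univ : Set Plane))
  heat_equation : ∀ x : KleinBottle b, ∀ t : ℝ, 0 < t → ∀ p : Plane,
    deriv (fun τ : ℝ => K τ x (proj b p)) t =
      Laplacian.laplacian (fun q : Plane => K t x (proj b q)) p
  initial_condition : ∀ x : KleinBottle b, ∀ f : KleinBottle b → ℝ, Continuous f →
    Filter.Tendsto (fun t : ℝ => ∫ y, K t x y * f y ∂(vol b))
      (nhdsWithin 0 (Set.Ioi 0)) (nhds (f x))

end KleinBottle

/-! The torus with periods `1` and `2 * b` covers the Klein bottle twice, so the heat kernel centred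
at `x` is the sum of two torus kernels, centred at `x` and at its glide image. Each torus kernel is
a product of circle kernels, given by theta series (`kleinHeat`, `isHeatKernelAt_descend`).

For large time, compare two points on one horizontal line. Modes independent of the first coordinate
cancel, and the slowest remaining one is `cos (2 * π * x₁)`, with eigenvalue `(2 * π) ^ 2`. Its
companion `sin (2 * π * x₁)` is not glide invariant, so the leading term is not a function of the
difference of the points: it is proportional to `cos (2 * π * x₁) * cos (2 * π * y₁)`. With `x₁ =
1/6` it is larger at `y₁ = 0` than at `y₁ = 1/6`. Hence the kernel eventually increases between the
ends of the horizontal segment from `(1/6, 0)` to `(0, 0)`, which is minimal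
(`tendsto_exp_mul_kleinHeat_sub`, `isMinimalGeodesic_horizontal`).

An arbitrary kernel agrees with this one by `IsHeatKernelAt.unique`: the difference of two kernels
lifts to the torus, each Fourier coefficient there is an exponential in time with limit zero at time
zero, and a continuous function without Fourier coefficients vanishes. -/

open Real Filter Topology Set MeasureTheory

/-! ### Theta series: smoothness, positivity, large-time behaviour -/

/-- The theta-type series `∑ nᵏ exp (-n² t) cos (n x + α)`. -/
noncomputable def thetaSeries (k : ℕ) (α t x : ℝ) : ℝ :=
  ∑' n : ℕ, (n : ℝ) ^ k * exp (-(n : ℝ) ^ 2 * t) * cos (n * x + α)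

theorem summable_pow_mul_exp_neg_sq (k : ℕ) {t : ℝ} (ht : 0 < t) :
    Summable fun n : ℕ => (n : ℝ) ^ k * exp (-(n : ℝ) ^ 2 * t) := by
  refine Summable.of_nonneg_of_le (fun n => by positivity) (fun n => ?_)
    (Real.summable_pow_mul_exp_neg_nat_mul k ht)
  have : (n : ℝ) ≤ (n : ℝ) ^ 2 := by exact_mod_cast Nat.le_self_pow two_ne_zero n
  refine mul_le_mul_of_nonneg_left (exp_le_exp.2 ?_) (by positivity)
  nlinarith

theorem abs_thetaSeries_term_le (k n : ℕ) (α : ℝ) {t₀ t : ℝ} (ht : t₀ ≤ t) (x : ℝ) :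
    |(n : ℝ) ^ k * exp (-(n : ℝ) ^ 2 * t) * cos (n * x + α)| ≤
      (n : ℝ) ^ k * exp (-(n : ℝ) ^ 2 * t₀) := by
  rw [abs_mul, abs_of_nonneg (by positivity : 0 ≤ (n : ℝ) ^ k * exp (-(n : ℝ) ^ 2 * t))]
  calc _ ≤ (n : ℝ) ^ k * exp (-(n : ℝ) ^ 2 * t) * 1 := by gcongr; exact abs_cos_le_one _
    _ ≤ _ := by
      rw [mul_one]
      gcongr ?_ * exp ?_
      nlinarith [sq_nonneg (n : ℝ)]

theorem summable_thetaSeries (k : ℕ) (α : ℝ) {t : ℝ} (ht : 0 < t) (x : ℝ) :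
    Summable fun n : ℕ => (n : ℝ) ^ k * exp (-(n : ℝ) ^ 2 * t) * cos (n * x + α) :=
  Summable.of_norm_bounded (summable_pow_mul_exp_neg_sq k ht)
    fun n => abs_thetaSeries_term_le k n α le_rfl x

/-- The parameters `k` and `α` make the family closed under differentiation: `∂ₜ` raises `k` by 2
with a sign, `∂ₓ` raises `k` by 1 and shifts the phase by `π / 2`. Termwise differentiation is
legitimate on times above `z.1 / 2`, where the derivatives have a summable majorant. -/
theorem hasFDerivAt_thetaSeries (k : ℕ) (α : ℝ) {z : ℝ × ℝ} (hz : 0 < z.1) :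
    HasFDerivAt (fun z : ℝ × ℝ => thetaSeries k α z.1 z.2)
      ((-thetaSeries (k + 2) α z.1 z.2) • ContinuousLinearMap.fst ℝ ℝ ℝ +
        thetaSeries (k + 1) (α + π / 2) z.1 z.2 • ContinuousLinearMap.snd ℝ ℝ ℝ) z := by
  set t₀ := z.1 / 2
  have ht₀ : 0 < t₀ := half_pos hz
  have hzt : t₀ < z.1 := half_lt_self hz
  let s : Set (ℝ × ℝ) := Ioi t₀ ×ˢ univ
  have hs : IsOpen s := isOpen_Ioi.prod isOpen_univ
  have h's : IsPreconnected s := isPreconnected_Ioi.prod isPreconnected_univ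
  let A (j n : ℕ) (β : ℝ) (y : ℝ × ℝ) : ℝ :=
    (n : ℝ) ^ j * exp (-(n : ℝ) ^ 2 * y.1) * cos (n * y.2 + β)
  let f' (n : ℕ) (y : ℝ × ℝ) : ℝ × ℝ →L[ℝ] ℝ :=
    (-A (k + 2) n α y) • ContinuousLinearMap.fst ℝ ℝ ℝ +
      A (k + 1) n (α + π / 2) y • ContinuousLinearMap.snd ℝ ℝ ℝ
  have key := hasFDerivAt_tsum_of_isPreconnected (𝕜 := ℝ) (x := z) (x₀ := z)
    (f := fun n y => A k n α y) (f' := f') (s := s)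
    ((summable_pow_mul_exp_neg_sq (k + 2) ht₀).add (summable_pow_mul_exp_neg_sq (k + 1) ht₀))
    hs h's ?_ ?_ ⟨hzt, mem_univ _⟩ (summable_thetaSeries k α hz z.2) ⟨hzt, mem_univ _⟩
  · refine key.congr_fderiv ?_
    refine HasSum.tsum_eq ?_
    refine HasSum.add (HasSum.smul_const ?_ _) (HasSum.smul_const ?_ _)
    · exact (summable_thetaSeries (k + 2) α hz z.2).hasSum.neg
    · exact (summable_thetaSeries (k + 1) _ hz z.2).hasSum
  · intro n y _
    have h1 : HasFDerivAt (fun y : ℝ × ℝ => -(n : ℝ) ^ 2 * y.1)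
        ((-(n : ℝ) ^ 2) • ContinuousLinearMap.fst ℝ ℝ ℝ) y := hasFDerivAt_fst.const_mul _
    have h2 : HasFDerivAt (fun y : ℝ × ℝ => (n : ℝ) * y.2 + α)
        ((n : ℝ) • ContinuousLinearMap.snd ℝ ℝ ℝ) y := (hasFDerivAt_snd.const_mul _).add_const _
    refine ((h1.exp.const_mul ((n : ℝ) ^ k)).mul h2.cos).congr_fderiv ?_
    ext <;> simp [f', A, cos_add_pi_div_two, ← add_assoc] <;> ring
  · intro n y hy
    have hy1 : t₀ ≤ y.1 := (mem_Ioi.1 hy.1).le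
    refine (norm_add_le _ _).trans (add_le_add ?_ ?_)
    · rw [norm_smul, norm_neg]
      calc _ ≤ ‖A (k + 2) n α y‖ * 1 := by gcongr; exact ContinuousLinearMap.norm_fst_le ..
        _ ≤ _ := by rw [mul_one]; exact abs_thetaSeries_term_le _ _ _ hy1 _
    · rw [norm_smul]
      calc _ ≤ ‖A (k + 1) n (α + π / 2) y‖ * 1 := by
            gcongr; exact ContinuousLinearMap.norm_snd_le ..
        _ ≤ _ := by rw [mul_one]; exact abs_thetaSeries_term_le _ _ _ hy1 _

theorem contDiffOn_thetaSeries (k : ℕ) (α : ℝ) :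
    ContDiffOn ℝ (⊤ : ℕ∞) (fun z : ℝ × ℝ => thetaSeries k α z.1 z.2) (Ioi 0 ×ˢ univ) := by
  have hs : IsOpen (Ioi (0 : ℝ) ×ˢ (univ : Set ℝ)) := isOpen_Ioi.prod isOpen_univ
  refine contDiffOn_infty.2 fun N => ?_
  induction N generalizing k α with
  | zero =>
    rw [Nat.cast_zero, contDiffOn_zero]
    exact fun z hz => (hasFDerivAt_thetaSeries k α hz.1).continuousAt.continuousWithinAt
  | succ N ih =>
    rw [Nat.cast_add, Nat.cast_one, contDiffOn_succ_iff_fderiv_of_isOpen hs]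
    refine ⟨fun z hz =>
      (hasFDerivAt_thetaSeries k α hz.1).differentiableAt.differentiableWithinAt, by simp, ?_⟩
    refine ContDiffOn.congr ?_ fun z hz => (hasFDerivAt_thetaSeries k α hz.1).fderiv
    exact ((ih _ _).neg.smul contDiffOn_const).add ((ih _ _).smul contDiffOn_const)

theorem hasDerivAt_thetaSeries_time (k : ℕ) (α : ℝ) {t : ℝ} (ht : 0 < t) (x : ℝ) :
    HasDerivAt (fun τ => thetaSeries k α τ x) (-thetaSeries (k + 2) α t x) t := by
  have h := (hasFDerivAt_thetaSeries k α (z := (t, x)) ht).comp_hasDerivAt t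
    ((hasDerivAt_id t).prodMk (hasDerivAt_const t x))
  simpa [Function.comp_def] using! h

theorem hasDerivAt_thetaSeries_space (k : ℕ) (α : ℝ) {t : ℝ} (ht : 0 < t) (x : ℝ) :
    HasDerivAt (fun y => thetaSeries k α t y) (thetaSeries (k + 1) (α + π / 2) t x) x := by
  have h := (hasFDerivAt_thetaSeries k α (z := (t, x)) ht).comp_hasDerivAt x
    ((hasDerivAt_const x t).prodMk (hasDerivAt_id x))
  simpa [Function.comp_def] using! h

theorem thetaSeries_add_pi (k : ℕ) (α t x : ℝ) :
    thetaSeries k (α + π) t x = -thetaSeries k α t x := by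
  simp only [thetaSeries, ← add_assoc, cos_add_pi, mul_neg, tsum_neg]

theorem thetaSeries_add_two_pi (k : ℕ) (α t x : ℝ) :
    thetaSeries k α t (x + 2 * π) = thetaSeries k α t x := by
  refine tsum_congr fun n => ?_
  rw [show (n : ℝ) * (x + 2 * π) + α = n * x + α + n * (2 * π) by ring, cos_add_nat_mul_two_pi]

theorem thetaSeries_neg (k : ℕ) (t x : ℝ) : thetaSeries k 0 t (-x) = thetaSeries k 0 t x := by
  refine tsum_congr fun n => ?_
  rw [← cos_neg]
  ring_nf

/-- The theta function `1 + 2 ∑_{n ≥ 1} exp (-n² t) cos (n x)` is nonnegative. -/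
theorem two_mul_thetaSeries_sub_one_nonneg {t : ℝ} (ht : 0 < t) (x : ℝ) :
    0 ≤ 2 * thetaSeries 0 0 t x - 1 := by
  have hp := pi_pos
  have h1 := HurwitzZeta.hasSum_nat_cosKernel₀ (x / (2 * π)) (div_pos ht hp)
  have h2 := (summable_thetaSeries 0 0 ht x).hasSum
  rw [← hasSum_nat_add_iff' 1] at h2
  have h3 := h2.mul_left 2
  have h4 : HurwitzZeta.cosKernel ((x / (2 * π) : ℝ) : UnitAddCircle) (t / π) - 1 =
      2 * (thetaSeries 0 0 t x - 1) := by
    have e : ∀ n : ℕ, 2 * cos (2 * π * (x / (2 * π)) * ((n : ℝ) + 1)) *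
        exp (-π * ((n : ℝ) + 1) ^ 2 * (t / π)) =
        2 * (((n + 1 : ℕ) : ℝ) ^ 0 * exp (-((n + 1 : ℕ) : ℝ) ^ 2 * t) *
          cos (((n + 1 : ℕ) : ℝ) * x + 0)) := by
      intro n
      rw [show 2 * π * (x / (2 * π)) * ((n : ℝ) + 1) = ((n + 1 : ℕ) : ℝ) * x + 0 by
          push_cast; field_simp; ring,
        show -π * ((n : ℝ) + 1) ^ 2 * (t / π) = -((n + 1 : ℕ) : ℝ) ^ 2 * t by
          push_cast; field_simp]
      ring
    simp only [e] at h1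
    rw [h1.unique h3]
    simp [thetaSeries]
  -- The functional equation turns the cosine series into a positive multiple of a sum of Gaussians.
  have h5 : 0 ≤ HurwitzZeta.cosKernel ((x / (2 * π) : ℝ) : UnitAddCircle) (t / π) := by
    have h6 := HurwitzZeta.evenKernel_functional_equation ((x / (2 * π) : ℝ) : UnitAddCircle)
      (π / t)
    rw [one_div_div] at h6
    have h7 : 0 ≤ HurwitzZeta.evenKernel ((x / (2 * π) : ℝ) : UnitAddCircle) (π / t) :=
      (HurwitzZeta.hasSum_int_evenKernel _ (div_pos hp ht)).nonneg fun n => (exp_pos _).le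
    rw [h6] at h7
    exact nonneg_of_mul_nonneg_right h7 (by positivity)
  linarith

/-- After removal of the constant term, only the frequency 1 survives multiplication by `exp t`; the
summation index below is the frequency minus one. -/
theorem tendsto_exp_mul_thetaSeries_sub_one (x : ℝ) :
    Tendsto (fun t => exp t * (thetaSeries 0 0 t x - 1)) atTop (𝓝 (cos x)) := by
  have hb : Summable fun n : ℕ => exp (-(n : ℝ)) := by
    simpa using Real.summable_pow_mul_exp_neg_nat_mul 0 one_pos
  have key := tendsto_tsum_of_dominated_convergence (𝓕 := (atTop : Filter ℝ)) (β := ℕ)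
    (f := fun t n => exp t * (exp (-((n : ℝ) + 1) ^ 2 * t) * cos ((n + 1) * x)))
    (g := fun n => if n = 0 then cos x else 0) hb ?_ ?_
  · simp only [tsum_ite_eq] at key
    refine key.congr' ?_
    filter_upwards [eventually_gt_atTop 0] with t ht
    have h2 := (summable_thetaSeries 0 0 ht x).hasSum
    rw [← hasSum_nat_add_iff' 1] at h2
    have h3 := (h2.mul_left (exp t)).tsum_eq
    simpa [thetaSeries] using h3
  · intro n
    have e : ∀ t : ℝ, exp t * (exp (-((n : ℝ) + 1) ^ 2 * t) * cos ((n + 1) * x)) =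
        exp (-(((n : ℝ) + 1) ^ 2 - 1) * t) * cos ((n + 1) * x) := by
      intro t
      rw [← mul_assoc, ← exp_add]
      ring_nf
    simp only [e]
    split_ifs with hn
    · subst hn; simp
    · have hn' : (1 : ℝ) ≤ n := by exact_mod_cast Nat.one_le_iff_ne_zero.2 hn
      have : Tendsto (fun t : ℝ => exp (-(((n : ℝ) + 1) ^ 2 - 1) * t)) atTop (𝓝 0) := by
        refine tendsto_exp_atBot.comp ?_
        exact tendsto_id.const_mul_atTop_of_neg (by nlinarith)
      simpa using this.mul_const (cos ((n + 1) * x))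
  -- For `t ≥ 1` the exponent is `-(n² + 2n)t ≤ -n`, which gives the summable majorant `exp (-n)`.
  · filter_upwards [eventually_ge_atTop 1] with t ht n
    rw [← mul_assoc, ← exp_add, norm_mul, norm_eq_abs, norm_eq_abs, abs_of_pos (exp_pos _)]
    calc _ ≤ exp (t + -((n : ℝ) + 1) ^ 2 * t) * 1 := by gcongr; exact abs_cos_le_one _
      _ ≤ _ := by
        rw [mul_one]
        have : (0 : ℝ) ≤ n := n.cast_nonneg
        gcongr
        nlinarith [mul_nonneg this (sub_nonneg.2 ht), mul_nonneg (mul_nonneg this this) (sub_nonneg.2 ht)]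

theorem tendsto_thetaSeries_atTop (x : ℝ) :
    Tendsto (fun t => thetaSeries 0 0 t x) atTop (𝓝 1) := by
  have h := (tendsto_exp_mul_thetaSeries_sub_one x).mul
    (tendsto_exp_neg_atTop_nhds_zero)
  have h2 := h.add_const 1
  simp only [mul_zero, zero_add] at h2
  refine h2.congr fun t => ?_
  rw [mul_right_comm, ← exp_add]
  simp

/-! ### Mean and first cosine coefficient of the theta series -/

theorem integral_cos_int_mul {k : ℤ} (hk : k ≠ 0) : ∫ x in 0..2 * π, cos (k * x) = 0 := by
  have hk' : (k : ℝ) ≠ 0 := by exact_mod_cast hk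
  rw [intervalIntegral.integral_comp_mul_left (fun x => cos x) hk', integral_cos]
  have : sin (k * (2 * π)) = 0 := by
    simpa using sin_int_mul_two_pi_sub 0 k
  simp [this]

theorem integral_cos_nat_mul (n : ℕ) :
    ∫ x in 0..2 * π, cos (n * x) = if n = 0 then 2 * π else 0 := by
  split_ifs with h
  · subst h; simp
  · exact_mod_cast integral_cos_int_mul (k := n) (by exact_mod_cast h)

theorem integral_cos_nat_mul_mul_cos (n : ℕ) :
    ∫ x in 0..2 * π, cos (n * x) * cos x = if n = 1 then π else 0 := by
  have e : ∀ x : ℝ, cos (n * x) * cos x =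
      (cos (((n + 1 : ℤ) : ℝ) * x) + cos (((n - 1 : ℤ) : ℝ) * x)) / 2 := by
    intro x
    push_cast
    rw [add_mul, sub_mul, one_mul, cos_add, cos_sub]
    ring
  simp only [e]
  rw [intervalIntegral.integral_div, intervalIntegral.integral_add
    (Continuous.intervalIntegrable (by fun_prop) _ _)
    (Continuous.intervalIntegrable (by fun_prop) _ _), integral_cos_int_mul (by omega)]
  split_ifs with h
  · subst h; simp
  · rw [integral_cos_int_mul (by omega)]; simp

theorem hasSum_integral_thetaSeries_mul {g : ℝ → ℝ} (hg : Continuous g) (hg1 : ∀ x, |g x| ≤ 1)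
    {t : ℝ} (ht : 0 < t) (a b : ℝ) :
    HasSum (fun n : ℕ => exp (-(n : ℝ) ^ 2 * t) * ∫ x in a..b, cos (n * x) * g x)
      (∫ x in a..b, thetaSeries 0 0 t x * g x) := by
  have key := intervalIntegral.hasSum_integral_of_dominated_convergence (μ := MeasureTheory.volume)
    (a := a) (b := b)
    (F := fun (n : ℕ) x => exp (-(n : ℝ) ^ 2 * t) * (cos (n * x) * g x))
    (f := fun x => thetaSeries 0 0 t x * g x)
    (fun n _ => exp (-(n : ℝ) ^ 2 * t)) ?_ ?_ ?_ ?_ ?_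
  · simpa only [intervalIntegral.integral_const_mul] using key
  · exact fun n => (by fun_prop : Continuous _).aestronglyMeasurable
  · intro n
    refine .of_forall fun x _ => ?_
    rw [norm_mul, norm_mul, norm_eq_abs, abs_of_pos (exp_pos _)]
    refine mul_le_of_le_one_right (exp_pos _).le ?_
    exact mul_le_one₀ (abs_cos_le_one _) (abs_nonneg _) (hg1 x)
  · exact .of_forall fun x _ => by simpa using summable_pow_mul_exp_neg_sq 0 ht
  · exact intervalIntegrable_const
  · refine .of_forall fun x _ => ?_
    convert! (summable_thetaSeries 0 0 ht x).hasSum.mul_right (g x) using 2 with n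
    simp [mul_assoc]

theorem integral_thetaSeries {t : ℝ} (ht : 0 < t) :
    ∫ x in 0..2 * π, thetaSeries 0 0 t x = 2 * π := by
  have h := hasSum_integral_thetaSeries_mul (g := fun _ => 1) continuous_const (by simp) ht 0 (2 * π)
  simp only [mul_one, integral_cos_nat_mul] at h
  rw [h.unique (hasSum_single 0 fun n hn => by simp [hn])]
  simp

theorem integral_thetaSeries_mul_cos {t : ℝ} (ht : 0 < t) :
    ∫ x in 0..2 * π, thetaSeries 0 0 t x * cos x = π * exp (-t) := by
  have h := hasSum_integral_thetaSeries_mul (g := cos) continuous_cos abs_cos_le_one ht 0 (2 * π)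
  simp only [integral_cos_nat_mul_mul_cos] at h
  rw [h.unique (hasSum_single 1 fun n hn => by simp [hn])]
  simp [mul_comm]

/-! ### The heat kernel of the circle -/

/-- The heat kernel of the circle of length `L`, as a function of the difference of the points. -/
noncomputable def circleHeat (L t x : ℝ) : ℝ :=
  (2 * thetaSeries 0 0 ((2 * π / L) ^ 2 * t) (2 * π / L * x) - 1) / L

section CircleHeat

variable {L : ℝ}

theorem contDiffOn_circleHeat (hL : 0 < L) :
    ContDiffOn ℝ (⊤ : ℕ∞) (fun z : ℝ × ℝ => circleHeat L z.1 z.2) (Ioi 0 ×ˢ univ) := by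
  have hω : 0 < 2 * π / L := by positivity
  have h := (contDiffOn_thetaSeries 0 0).comp (s := Ioi (0 : ℝ) ×ˢ (univ : Set ℝ))
    (g := fun z : ℝ × ℝ => thetaSeries 0 0 z.1 z.2)
    (f := fun z : ℝ × ℝ => ((2 * π / L) ^ 2 * z.1, 2 * π / L * z.2))
    (ContDiff.contDiffOn (by fun_prop))
    (fun z hz => ⟨mul_pos (pow_pos hω 2) hz.1, mem_univ _⟩)
  exact ((contDiffOn_const.mul h).sub contDiffOn_const).div_const L

theorem contDiff_circleHeat (hL : 0 < L) {t : ℝ} (ht : 0 < t) :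
    ContDiff ℝ (⊤ : ℕ∞) (circleHeat L t) := by
  rw [← contDiffOn_univ]
  exact (contDiffOn_circleHeat hL).comp (s := univ) (f := fun x : ℝ => (t, x))
    (ContDiff.contDiffOn (by fun_prop)) fun x _ => ⟨ht, mem_univ _⟩

theorem hasDerivAt_circleHeat_time (hL : 0 < L) {t : ℝ} (ht : 0 < t) (x : ℝ) :
    HasDerivAt (fun τ => circleHeat L τ x) (deriv (deriv (circleHeat L t)) x) t := by
  have hω : 0 < 2 * π / L := by positivity
  set ω := 2 * π / L with hω'
  have hωt : 0 < ω ^ 2 * t := by positivity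
  have hs (k : ℕ) (α y : ℝ) : HasDerivAt (fun y => thetaSeries k α (ω ^ 2 * t) (ω * y))
      (thetaSeries (k + 1) (α + π / 2) (ω ^ 2 * t) (ω * y) * ω) y :=
    (hasDerivAt_thetaSeries_space k α hωt (ω * y)).comp y
      (by simpa using (hasDerivAt_id y).const_mul ω)
  have h1 : deriv (circleHeat L t) =
      fun y => 2 * (thetaSeries 1 (0 + π / 2) (ω ^ 2 * t) (ω * y) * ω) / L := by
    ext y
    exact ((((hs 0 0 y).const_mul 2).sub_const 1).div_const L).deriv
  have h2 : deriv (deriv (circleHeat L t)) x =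
      2 * (-thetaSeries 2 0 (ω ^ 2 * t) (ω * x) * ω ^ 2) / L := by
    rw [h1, (((((hs 1 (0 + π / 2) x).mul_const ω).const_mul 2)).div_const L).deriv,
      show (0 : ℝ) + π / 2 + π / 2 = 0 + π by ring, thetaSeries_add_pi]
    ring
  rw [h2]
  have h3 : HasDerivAt (fun τ => thetaSeries 0 0 (ω ^ 2 * τ) (ω * x))
      (-thetaSeries 2 0 (ω ^ 2 * t) (ω * x) * ω ^ 2) t :=
    (hasDerivAt_thetaSeries_time 0 0 hωt (ω * x)).comp t
      (by simpa using (hasDerivAt_id t).const_mul (ω ^ 2))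
  exact ((h3.const_mul 2).sub_const 1).div_const L

theorem circleHeat_periodic (hL : 0 < L) (t : ℝ) : Function.Periodic (circleHeat L t) L := by
  intro x
  rw [circleHeat, show 2 * π / L * (x + L) = 2 * π / L * x + 2 * π by field_simp,
    thetaSeries_add_two_pi, circleHeat]

theorem circleHeat_neg (t x : ℝ) : circleHeat L t (-x) = circleHeat L t x := by
  rw [circleHeat, mul_neg, thetaSeries_neg, circleHeat]

theorem circleHeat_nonneg (hL : 0 < L) {t : ℝ} (ht : 0 < t) (x : ℝ) : 0 ≤ circleHeat L t x :=
  div_nonneg (two_mul_thetaSeries_sub_one_nonneg (by positivity) _) hL.le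

theorem integral_circleHeat (hL : 0 < L) {t : ℝ} (ht : 0 < t) (x₀ : ℝ) :
    ∫ x in 0..L, circleHeat L t (x - x₀) = 1 := by
  rw [intervalIntegral.integral_comp_sub_right, zero_sub, ← neg_add_eq_sub,
    (circleHeat_periodic hL t).intervalIntegral_add_eq (-x₀) 0, zero_add]
  have hω : 0 < 2 * π / L := by positivity
  simp only [circleHeat]
  rw [intervalIntegral.integral_div, intervalIntegral.integral_comp_mul_left
    (fun x => 2 * thetaSeries 0 0 ((2 * π / L) ^ 2 * t) x - 1) hω.ne', intervalIntegral.integral_sub,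
    intervalIntegral.integral_const_mul, mul_zero, div_mul_cancel₀ _ hL.ne',
    integral_thetaSeries (by positivity)]
  · simp
    field_simp
    ring
  · refine Continuous.intervalIntegrable ?_ _ _
    exact continuous_const.mul (continuous_iff_continuousAt.2 fun x =>
      (hasDerivAt_thetaSeries_space 0 0 (by positivity) x).continuousAt)
  · exact intervalIntegrable_const

/-- Together with total mass one and nonnegativity, this single moment forces concentration at `x₀`
as `t → 0+`, since it tends to one. -/
theorem integral_circleHeat_mul_cos (hL : 0 < L) {t : ℝ} (ht : 0 < t) (x₀ : ℝ) :
    ∫ x in 0..L, circleHeat L t (x - x₀) * cos (2 * π / L * (x - x₀)) =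
      exp (-((2 * π / L) ^ 2 * t)) := by
  have hper : Function.Periodic (fun x => circleHeat L t x * cos (2 * π / L * x)) L := by
    intro x
    simp only
    rw [circleHeat_periodic hL, show 2 * π / L * (x + L) = 2 * π / L * x + 2 * π by field_simp,
      cos_add_two_pi]
  rw [intervalIntegral.integral_comp_sub_right
    (fun x => circleHeat L t x * cos (2 * π / L * x)), zero_sub, ← neg_add_eq_sub,
    hper.intervalIntegral_add_eq (-x₀) 0, zero_add]
  have hω : 0 < 2 * π / L := by positivity
  have e : ∀ x, circleHeat L t x * cos (2 * π / L * x) =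
      (fun y => (2 * (thetaSeries 0 0 ((2 * π / L) ^ 2 * t) y * cos y) - cos y) / L)
        (2 * π / L * x) := fun x => by simp only [circleHeat]; ring
  simp only [e]
  rw [intervalIntegral.integral_comp_mul_left
    (fun y => (2 * (thetaSeries 0 0 ((2 * π / L) ^ 2 * t) y * cos y) - cos y) / L) hω.ne',
    intervalIntegral.integral_div, intervalIntegral.integral_sub,
    intervalIntegral.integral_const_mul, mul_zero, div_mul_cancel₀ _ hL.ne',
    integral_thetaSeries_mul_cos (by positivity), integral_cos]
  · simp
    field_simp
  · refine Continuous.intervalIntegrable ?_ _ _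
    exact continuous_const.mul ((continuous_iff_continuousAt.2 fun x =>
      (hasDerivAt_thetaSeries_space 0 0 (by positivity) x).continuousAt).mul continuous_cos)
  · exact continuous_cos.intervalIntegrable _ _

theorem tendsto_circleHeat_atTop (hL : 0 < L) (x : ℝ) :
    Tendsto (fun t => circleHeat L t x) atTop (𝓝 (1 / L)) := by
  have hω : 0 < (2 * π / L) ^ 2 := by positivity
  have h := (tendsto_thetaSeries_atTop (2 * π / L * x)).comp (tendsto_id.const_mul_atTop hω)
  have h2 := ((h.const_mul 2).sub_const 1).div_const L
  norm_num at h2 ⊢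
  exact h2

/-- The constant mode cancels in the difference, leaving the first mode as leading term. -/
theorem tendsto_exp_mul_circleHeat_sub (hL : 0 < L) (x y : ℝ) :
    Tendsto (fun t => exp ((2 * π / L) ^ 2 * t) * (circleHeat L t x - circleHeat L t y)) atTop
      (𝓝 (2 / L * (cos (2 * π / L * x) - cos (2 * π / L * y)))) := by
  have hω : 0 < (2 * π / L) ^ 2 := by positivity
  have h (z : ℝ) := (tendsto_exp_mul_thetaSeries_sub_one (2 * π / L * z)).comp
    (tendsto_id.const_mul_atTop hω)
  refine (((h x).sub (h y)).const_mul (2 / L)).congr fun t => ?_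
  simp only [Function.comp, circleHeat, id]
  ring

end CircleHeat

/-! ### Fourier uniqueness and integrals over a rectangle -/

/-- The phases `0` and `π / 2` give the real and imaginary parts of the complex Fourier
coefficients. All being zero, they are summable, so the Fourier series converges to `g` at every
point. -/
theorem periodic_eq_zero_of_integral_mul_cos_eq_zero {L : ℝ} (hL : 0 < L) {g : ℝ → ℝ}
    (hg : Continuous g) (hper : Function.Periodic g L)
    (h : ∀ (n : ℤ) (α : ℝ), ∫ x in 0..L, g x * cos (2 * π / L * n * x + α) = 0) (x : ℝ) :
    g x = 0 := by
  have : Fact (0 < L) := ⟨hL⟩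
  have hper' : Function.Periodic (fun x => (g x : ℂ)) L := fun x => by simp [hper x]
  let F : C(AddCircle L, ℂ) := ⟨hper'.lift,
    continuous_coinduced_dom.2 (Complex.continuous_ofReal.comp hg)⟩
  have hF : ∀ x : ℝ, F (x : AddCircle L) = g x := fun x => hper'.lift_coe x
  have hcoeff : ∀ n : ℤ, fourierCoeff F n = 0 := by
    intro n
    rw [fourierCoeff_eq_intervalIntegral _ n 0, zero_add]
    have e : ∀ x : ℝ, fourier (-n) (x : AddCircle L) • F (x : AddCircle L) =
        ((g x * cos (2 * π / L * n * x + 0) : ℝ) : ℂ) +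
          ((g x * cos (2 * π / L * n * x + π / 2) : ℝ) : ℂ) * Complex.I := by
      intro x
      rw [hF, fourier_coe_apply, cos_add_pi_div_two, add_zero, smul_eq_mul,
        show 2 * (π : ℂ) * Complex.I * ((-n : ℤ) : ℂ) * x / L =
          ((-(2 * π / L * n * x) : ℝ) : ℂ) * Complex.I by push_cast; ring, Complex.exp_mul_I,
        ← Complex.ofReal_cos, ← Complex.ofReal_sin, cos_neg, sin_neg]
      push_cast
      ring
    simp only [e]
    rw [intervalIntegral.integral_add (Continuous.intervalIntegrable (by fun_prop) _ _)
      (Continuous.intervalIntegrable (by fun_prop) _ _), intervalIntegral.integral_mul_const,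
      intervalIntegral.integral_ofReal, intervalIntegral.integral_ofReal, h, h]
    simp
  have hsum : Summable (fourierCoeff F) := by
    rw [show fourierCoeff F = fun _ => (0 : ℂ) from funext hcoeff]
    exact summable_zero
  have := has_pointwise_sum_fourier_series_of_summable hsum (x : AddCircle L)
  simp only [hcoeff, zero_smul, hF] at this
  exact_mod_cast this.unique hasSum_zero

theorem hasDerivAt_setIntegral_of_continuousOn {K : Set (ℝ × ℝ)} (hK : IsCompact K)
    {F F' : ℝ → ℝ × ℝ → ℝ}
    (hF : ContinuousOn (fun z : ℝ × ℝ × ℝ => F z.1 z.2) (Ioi 0 ×ˢ univ))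
    (hF' : ContinuousOn (fun z : ℝ × ℝ × ℝ => F' z.1 z.2) (Ioi 0 ×ˢ univ))
    (hd : ∀ t, 0 < t → ∀ z, HasDerivAt (fun τ => F τ z) (F' t z) t) {t : ℝ} (ht : 0 < t) :
    HasDerivAt (fun τ => ∫ z in K, F τ z) (∫ z in K, F' t z) t := by
  have hFt : ∀ τ, 0 < τ → Continuous (F τ) := fun τ hτ =>
    continuousOn_univ.1 (hF.comp (f := fun z : ℝ × ℝ => (τ, z)) (s := univ)
      (Continuous.continuousOn (by fun_prop)) fun z _ => ⟨hτ, mem_univ _⟩)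
  have hFt' : ∀ τ, 0 < τ → Continuous (F' τ) := fun τ hτ =>
    continuousOn_univ.1 (hF'.comp (f := fun z : ℝ × ℝ => (τ, z)) (s := univ)
      (Continuous.continuousOn (by fun_prop)) fun z _ => ⟨hτ, mem_univ _⟩)
  obtain ⟨C, hC⟩ := (isCompact_Icc (a := t / 2) (b := 2 * t)).prod hK |>.exists_bound_of_continuousOn
    (hF'.mono fun z hz => ⟨(half_pos ht).trans_le hz.1.1, mem_univ _⟩)
  have hs : Ioo (t / 2) (2 * t) ∈ 𝓝 t := Ioo_mem_nhds (by linarith) (by linarith)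
  refine (hasDerivAt_integral_of_dominated_loc_of_deriv_le (bound := fun _ => C) hs ?_ ?_ ?_ ?_ ?_
    ?_).2
  · filter_upwards [lt_mem_nhds ht] with τ hτ
    exact (hFt τ hτ).aestronglyMeasurable
  · exact (hFt t ht).continuousOn.integrableOn_compact hK
  · exact (hFt' t ht).aestronglyMeasurable
  · filter_upwards [ae_restrict_mem hK.measurableSet] with z hz τ hτ
    exact hC (τ, z) ⟨⟨hτ.1.le, hτ.2.le⟩, hz⟩
  · exact continuousOn_const.integrableOn_compact hK
  · exact .of_forall fun z τ hτ => hd τ ((half_pos ht).trans hτ.1) z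

theorem setIntegral_Icc_prod_Icc {Φ : ℝ × ℝ → ℝ} (hΦ : Continuous Φ) {L₁ L₂ : ℝ} (h₁ : 0 ≤ L₁)
    (h₂ : 0 ≤ L₂) :
    ∫ z in Icc 0 L₁ ×ˢ Icc 0 L₂, Φ z = ∫ a in 0..L₁, ∫ c in 0..L₂, Φ (a, c) := by
  rw [Measure.volume_eq_prod, setIntegral_prod _
    (hΦ.continuousOn.integrableOn_compact (isCompact_Icc.prod isCompact_Icc)),
    intervalIntegral.integral_of_le h₁, integral_Icc_eq_integral_Ioc]
  simp only [intervalIntegral.integral_of_le h₂, integral_Icc_eq_integral_Ioc]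

theorem setIntegral_Icc_prod_Icc_symm {Φ : ℝ × ℝ → ℝ} (hΦ : Continuous Φ) {L₁ L₂ : ℝ}
    (h₁ : 0 ≤ L₁) (h₂ : 0 ≤ L₂) :
    ∫ z in Icc 0 L₁ ×ˢ Icc 0 L₂, Φ z = ∫ c in 0..L₂, ∫ a in 0..L₁, Φ (a, c) := by
  rw [Measure.volume_eq_prod, ← setIntegral_prod_swap]
  exact setIntegral_Icc_prod_Icc (Φ := fun z => Φ z.swap) (by fun_prop) h₂ h₁

/-- Two integrations by parts; the boundary terms cancel by periodicity. -/
theorem integral_deriv_deriv_mul_cos {L : ℝ} (hL : 0 < L) {f : ℝ → ℝ} (hf : ContDiff ℝ 2 f)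
    (hper : Function.Periodic f L) (n : ℤ) (α : ℝ) :
    ∫ x in 0..L, deriv (deriv f) x * cos (2 * π / L * n * x + α) =
      -(2 * π / L * n) ^ 2 * ∫ x in 0..L, f x * cos (2 * π / L * n * x + α) := by
  set ω := 2 * π / L * n with hω
  have hd1 : ContDiff ℝ 1 (deriv f) := hf.deriv'
  have hd2 : Continuous (deriv (deriv f)) := hd1.continuous_deriv le_rfl
  have hper' : Function.Periodic (deriv f) L := fun x => by
    rw [← deriv_comp_add_const, show (fun y => f (y + L)) = f from funext hper]
  have hlin (x : ℝ) : HasDerivAt (fun x => ω * x + α) ω x := by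
    simpa using ((hasDerivAt_id x).const_mul ω).add_const α
  have hF (x : ℝ) : HasDerivAt
      (fun x => deriv f x * cos (ω * x + α) + ω * (f x * sin (ω * x + α)))
      (deriv (deriv f) x * cos (ω * x + α) + ω ^ 2 * (f x * cos (ω * x + α))) x := by
    have h1 := ((hd1.differentiable one_ne_zero x).hasDerivAt).mul (hlin x).cos
    have h2 := (((hf.differentiable two_ne_zero x).hasDerivAt).mul (hlin x).sin).const_mul ω
    refine (h1.add h2).congr_deriv ?_
    ring
  have key := intervalIntegral.integral_eq_sub_of_hasDerivAt (a := 0) (b := L) (fun x _ => hF x)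
    (Continuous.intervalIntegrable (by have := hf.continuous; fun_prop) _ _)
  rw [intervalIntegral.integral_add
    (Continuous.intervalIntegrable (by fun_prop) _ _)
    (Continuous.intervalIntegrable (by have := hf.continuous; fun_prop) _ _),
    intervalIntegral.integral_const_mul] at key
  have e1 : ω * L + α = ω * 0 + α + n * (2 * π) := by rw [hω]; field_simp; ring
  have e2 : deriv f L = deriv f 0 := by simpa using hper' 0
  have e3 : f L = f 0 := by simpa using hper 0
  rw [e1, e2, e3, cos_add_int_mul_two_pi, sin_add_int_mul_two_pi, sub_self] at key
  linarith

/-! ### The heat equation on a flat torus and uniqueness -/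

theorem contDiff_deriv_fst {n : ℕ∞} {f : ℝ × ℝ → ℝ} (hf : ContDiff ℝ (n + 1 : ℕ∞) f) :
    ContDiff ℝ n (fun z : ℝ × ℝ => deriv (fun a => f (a, z.2)) z.1) := by
  have e : (fun z : ℝ × ℝ => deriv (fun a => f (a, z.2)) z.1) = fun z => fderiv ℝ f z (1, 0) := by
    ext z
    have hd : HasFDerivAt f (fderiv ℝ f z) (z.1, z.2) :=
      (hf.differentiable (by simp) z).hasFDerivAt
    exact (hd.comp_hasDerivAt z.1 ((hasDerivAt_id z.1).prodMk (hasDerivAt_const z.1 z.2))).deriv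
  rw [e]
  exact (hf.fderiv_right (by simp)).clm_apply contDiff_const

theorem contDiff_deriv_snd {n : ℕ∞} {f : ℝ × ℝ → ℝ} (hf : ContDiff ℝ (n + 1 : ℕ∞) f) :
    ContDiff ℝ n (fun z : ℝ × ℝ => deriv (fun c => f (z.1, c)) z.2) := by
  have e : (fun z : ℝ × ℝ => deriv (fun c => f (z.1, c)) z.2) = fun z => fderiv ℝ f z (0, 1) := by
    ext z
    have hd : HasFDerivAt f (fderiv ℝ f z) (z.1, z.2) :=
      (hf.differentiable (by simp) z).hasFDerivAt
    exact (hd.comp_hasDerivAt z.2 ((hasDerivAt_const z.2 z.1).prodMk (hasDerivAt_id z.2))).deriv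
  rw [e]
  exact (hf.fderiv_right (by simp)).clm_apply contDiff_const

/-- The Laplacian of a function of two real variables, in terms of iterated derivatives. -/
noncomputable def planarLaplacian (f : ℝ × ℝ → ℝ) (z : ℝ × ℝ) : ℝ :=
  deriv (deriv fun a => f (a, z.2)) z.1 + deriv (deriv fun c => f (z.1, c)) z.2

/-- Smooth solutions of the heat equation for positive times on the torus with periods `L₁`, `L₂`,
read on the plane. -/
structure IsTorusHeat (L₁ L₂ : ℝ) (W : ℝ → ℝ × ℝ → ℝ) : Prop where
  smooth : ContDiffOn ℝ (⊤ : ℕ∞) (fun z : ℝ × ℝ × ℝ => W z.1 z.2) (Ioi 0 ×ˢ univ)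
  heat : ∀ t, 0 < t → ∀ z, HasDerivAt (fun τ => W τ z) (planarLaplacian (W t) z) t
  periodic_fst : ∀ t, 0 < t → ∀ a c, W t (a + L₁, c) = W t (a, c)
  periodic_snd : ∀ t, 0 < t → ∀ a c, W t (a, c + L₂) = W t (a, c)

theorem continuous_deriv_deriv_fst {f : ℝ × ℝ → ℝ} (hf : ContDiff ℝ 2 f) :
    Continuous fun z : ℝ × ℝ => deriv (deriv fun a => f (a, z.2)) z.1 :=
  (contDiff_deriv_fst (n := 0) (contDiff_deriv_fst (n := 1) hf)).continuous

theorem continuous_deriv_deriv_snd {f : ℝ × ℝ → ℝ} (hf : ContDiff ℝ 2 f) :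
    Continuous fun z : ℝ × ℝ => deriv (deriv fun c => f (z.1, c)) z.2 :=
  (contDiff_deriv_snd (n := 0) (contDiff_deriv_snd (n := 1) hf)).continuous

theorem contDiff_slice {W : ℝ → ℝ × ℝ → ℝ}
    (hW : ContDiffOn ℝ (⊤ : ℕ∞) (fun z : ℝ × ℝ × ℝ => W z.1 z.2) (Ioi 0 ×ˢ univ))
    {t : ℝ} (ht : 0 < t) : ContDiff ℝ (⊤ : ℕ∞) (W t) :=
  contDiffOn_univ.1 (hW.comp (f := fun z : ℝ × ℝ => (t, z)) (s := univ)
    (ContDiff.contDiffOn (by fun_prop)) fun z _ => ⟨ht, mem_univ _⟩)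

/-- A product of two trigonometric functions on the torus with periods `L₁`, `L₂`. -/
noncomputable def torusMode (L₁ L₂ : ℝ) (m n : ℤ) (α β : ℝ) (z : ℝ × ℝ) : ℝ :=
  cos (2 * π / L₁ * m * z.1 + α) * cos (2 * π / L₂ * n * z.2 + β)

theorem continuous_torusMode (L₁ L₂ : ℝ) (m n : ℤ) (α β : ℝ) :
    Continuous (torusMode L₁ L₂ m n α β) := by
  unfold torusMode
  fun_prop

theorem torusMode_add_fst {L₁ : ℝ} (h₁ : L₁ ≠ 0) (L₂ : ℝ) (m n : ℤ) (α β a c : ℝ) :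
    torusMode L₁ L₂ m n α β (a + L₁, c) = torusMode L₁ L₂ m n α β (a, c) := by
  simp only [torusMode]
  rw [show 2 * π / L₁ * m * (a + L₁) + α = 2 * π / L₁ * m * a + α + m * (2 * π) by
    field_simp; ring, cos_add_int_mul_two_pi]

theorem torusMode_add_snd (L₁ : ℝ) {L₂ : ℝ} (h₂ : L₂ ≠ 0) (m n : ℤ) (α β a c : ℝ) :
    torusMode L₁ L₂ m n α β (a, c + L₂) = torusMode L₁ L₂ m n α β (a, c) := by
  simp only [torusMode]
  rw [show 2 * π / L₂ * n * (c + L₂) + β = 2 * π / L₂ * n * c + β + n * (2 * π) by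
    field_simp; ring, cos_add_int_mul_two_pi]

theorem planarLaplacian_sub {f g : ℝ × ℝ → ℝ} (hf : ContDiff ℝ 2 f) (hg : ContDiff ℝ 2 g)
    (z : ℝ × ℝ) :
    planarLaplacian (fun z => f z - g z) z = planarLaplacian f z - planarLaplacian g z := by
  have key : ∀ {p q : ℝ → ℝ}, ContDiff ℝ 2 p → ContDiff ℝ 2 q → ∀ x,
      deriv (deriv fun y => p y - q y) x = deriv (deriv p) x - deriv (deriv q) x := by
    intro p q hp hq x
    have e : (deriv fun y => p y - q y) = fun y => deriv p y - deriv q y := funext fun y =>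
      deriv_fun_sub (hp.differentiable two_ne_zero y) (hq.differentiable two_ne_zero y)
    rw [e, deriv_fun_sub ((hp.deriv' (n := 1)).differentiable one_ne_zero x)
      ((hq.deriv' (n := 1)).differentiable one_ne_zero x)]
  simp only [planarLaplacian]
  rw [key (p := fun a => f (a, z.2)) (q := fun a => g (a, z.2)) (by fun_prop) (by fun_prop),
    key (p := fun c => f (z.1, c)) (q := fun c => g (z.1, c)) (by fun_prop) (by fun_prop)]
  ring

namespace IsTorusHeat

variable {L₁ L₂ : ℝ} {W : ℝ → ℝ × ℝ → ℝ}

theorem contDiff_two (hW : IsTorusHeat L₁ L₂ W) {t : ℝ} (ht : 0 < t) : ContDiff ℝ 2 (W t) :=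
  (contDiff_slice hW.smooth ht).of_le (WithTop.coe_le_coe.2 (le_top : (2 : ℕ∞) ≤ ⊤))

theorem sub {V : ℝ → ℝ × ℝ → ℝ} (hW : IsTorusHeat L₁ L₂ W) (hV : IsTorusHeat L₁ L₂ V) :
    IsTorusHeat L₁ L₂ fun t z => W t z - V t z where
  smooth := hW.smooth.sub hV.smooth
  heat t ht z := by
    rw [planarLaplacian_sub (hW.contDiff_two ht) (hV.contDiff_two ht)]
    exact (hW.heat t ht z).sub (hV.heat t ht z)
  periodic_fst t ht a c := by rw [hW.periodic_fst t ht, hV.periodic_fst t ht]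
  periodic_snd t ht a c := by rw [hW.periodic_snd t ht, hV.periodic_snd t ht]

/-- Joint continuity in time and space comes for free: by the heat equation the Laplacian is the
time derivative of a jointly smooth function. -/
theorem continuousOn_planarLaplacian (hW : IsTorusHeat L₁ L₂ W) :
    ContinuousOn (fun z : ℝ × ℝ × ℝ => planarLaplacian (W z.1) z.2) (Ioi 0 ×ˢ univ) := by
  have hs : IsOpen (Ioi (0 : ℝ) ×ˢ (univ : Set (ℝ × ℝ))) := isOpen_Ioi.prod isOpen_univ
  have h := (hW.smooth.continuousOn_fderiv_of_isOpen hs (by simp)).clm_apply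
    (continuousOn_const (c := ((1 : ℝ), (0 : ℝ × ℝ))))
  refine h.congr fun z hz => ?_
  have hd : HasFDerivAt (fun z : ℝ × ℝ × ℝ => W z.1 z.2)
      (fderiv ℝ (fun z : ℝ × ℝ × ℝ => W z.1 z.2) z) (z.1, z.2) :=
    ((hW.smooth.contDiffAt (hs.mem_nhds hz)).differentiableAt (by simp)).hasFDerivAt
  have hd' : HasDerivAt (fun τ => W τ z.2)
      (fderiv ℝ (fun z : ℝ × ℝ × ℝ => W z.1 z.2) z (1, 0)) z.1 :=
    HasFDerivAt.comp_hasDerivAt (f := fun τ => (τ, z.2)) z.1 hd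
      ((hasDerivAt_id' z.1).prodMk (hasDerivAt_const z.1 z.2))
  exact (hW.heat z.1 hz.1 z.2).unique hd'

theorem setIntegral_planarLaplacian_mul (hW : IsTorusHeat L₁ L₂ W) (h₁ : 0 < L₁) (h₂ : 0 < L₂)
    (m n : ℤ) (α β : ℝ) {t : ℝ} (ht : 0 < t) :
    ∫ z in Icc 0 L₁ ×ˢ Icc 0 L₂, planarLaplacian (W t) z * torusMode L₁ L₂ m n α β z =
      -((2 * π / L₁ * m) ^ 2 + (2 * π / L₂ * n) ^ 2) *
        ∫ z in Icc 0 L₁ ×ˢ Icc 0 L₂, W t z * torusMode L₁ L₂ m n α β z := by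
  have hf : ContDiff ℝ 2 (W t) := hW.contDiff_two ht
  have hfc := hf.continuous
  have hφ := continuous_torusMode L₁ L₂ m n α β
  have hc₁ := (continuous_deriv_deriv_fst hf).fun_mul hφ
  have hc₂ := (continuous_deriv_deriv_snd hf).fun_mul hφ
  have hK : IsCompact (Icc 0 L₁ ×ˢ Icc 0 L₂) := isCompact_Icc.prod isCompact_Icc
  have e₁ : ∫ z in Icc 0 L₁ ×ˢ Icc 0 L₂, deriv (deriv fun a => W t (a, z.2)) z.1 *
      torusMode L₁ L₂ m n α β z = -(2 * π / L₁ * m) ^ 2 *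
        ∫ z in Icc 0 L₁ ×ˢ Icc 0 L₂, W t z * torusMode L₁ L₂ m n α β z := by
    rw [setIntegral_Icc_prod_Icc_symm hc₁ h₁.le h₂.le,
      setIntegral_Icc_prod_Icc_symm (hfc.fun_mul hφ) h₁.le h₂.le,
      ← intervalIntegral.integral_const_mul]
    refine intervalIntegral.integral_congr fun c _ => ?_
    simp only [torusMode, ← mul_assoc]
    rw [intervalIntegral.integral_mul_const, intervalIntegral.integral_mul_const, ← mul_assoc,
      integral_deriv_deriv_mul_cos h₁ (f := fun a => W t (a, c)) (by fun_prop)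
        (fun a => hW.periodic_fst t ht a c)]
  have e₂ : ∫ z in Icc 0 L₁ ×ˢ Icc 0 L₂, deriv (deriv fun c => W t (z.1, c)) z.2 *
      torusMode L₁ L₂ m n α β z = -(2 * π / L₂ * n) ^ 2 *
        ∫ z in Icc 0 L₁ ×ˢ Icc 0 L₂, W t z * torusMode L₁ L₂ m n α β z := by
    rw [setIntegral_Icc_prod_Icc hc₂ h₁.le h₂.le,
      setIntegral_Icc_prod_Icc (hfc.fun_mul hφ) h₁.le h₂.le,
      ← intervalIntegral.integral_const_mul]
    refine intervalIntegral.integral_congr fun a _ => ?_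
    simp only [torusMode, mul_left_comm _ (cos (2 * π / L₁ * m * a + α))]
    rw [intervalIntegral.integral_const_mul, intervalIntegral.integral_const_mul,
      integral_deriv_deriv_mul_cos h₂ (f := fun c => W t (a, c)) (by fun_prop)
        (fun c => hW.periodic_snd t ht a c)]
    ring
  simp only [planarLaplacian, add_mul]
  rw [integral_add (hc₁.continuousOn.integrableOn_compact hK)
    (hc₂.continuousOn.integrableOn_compact hK), e₁, e₂]
  ring

theorem hasDerivAt_setIntegral_mul (hW : IsTorusHeat L₁ L₂ W) (h₁ : 0 < L₁) (h₂ : 0 < L₂)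
    (m n : ℤ) (α β : ℝ) {t : ℝ} (ht : 0 < t) :
    HasDerivAt (fun τ => ∫ z in Icc 0 L₁ ×ˢ Icc 0 L₂, W τ z * torusMode L₁ L₂ m n α β z)
      (-((2 * π / L₁ * m) ^ 2 + (2 * π / L₂ * n) ^ 2) *
        ∫ z in Icc 0 L₁ ×ˢ Icc 0 L₂, W t z * torusMode L₁ L₂ m n α β z) t := by
  have hφ : ContinuousOn (fun z : ℝ × ℝ × ℝ => torusMode L₁ L₂ m n α β z.2) (Ioi 0 ×ˢ univ) :=
    ((continuous_torusMode L₁ L₂ m n α β).comp continuous_snd).continuousOn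
  rw [← hW.setIntegral_planarLaplacian_mul h₁ h₂ m n α β ht]
  exact hasDerivAt_setIntegral_of_continuousOn (isCompact_Icc.prod isCompact_Icc)
    (F := fun τ z => W τ z * torusMode L₁ L₂ m n α β z)
    (hW.smooth.continuousOn.mul hφ) (hW.continuousOn_planarLaplacian.mul hφ)
    (fun τ hτ z => (hW.heat τ hτ z).mul_const _) ht

theorem setIntegral_mul_eq_zero (hW : IsTorusHeat L₁ L₂ W) (h₁ : 0 < L₁) (h₂ : 0 < L₂)
    (m n : ℤ) (α β : ℝ)
    (h : Tendsto (fun τ => ∫ z in Icc 0 L₁ ×ˢ Icc 0 L₂, W τ z * torusMode L₁ L₂ m n α β z)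
      (𝓝[>] 0) (𝓝 0)) {t : ℝ} (ht : 0 < t) :
    ∫ z in Icc 0 L₁ ×ˢ Icc 0 L₂, W t z * torusMode L₁ L₂ m n α β z = 0 := by
  set lam := (2 * π / L₁ * m) ^ 2 + (2 * π / L₂ * n) ^ 2 with hlam
  set I := fun τ => ∫ z in Icc 0 L₁ ×ˢ Icc 0 L₂, W τ z * torusMode L₁ L₂ m n α β z with hI
  -- The coefficient satisfies `I' = -lam * I`, so `exp (lam * τ) * I τ` is constant; its limit at
  -- `0+` identifies the constant as zero.
  have hd : ∀ τ ∈ Ioi (0 : ℝ), HasDerivAt (fun τ => exp (lam * τ) * I τ) 0 τ := fun τ hτ => by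
    have h1 : HasDerivAt (fun τ => exp (lam * τ)) (exp (lam * τ) * lam) τ := by
      simpa using ((hasDerivAt_id τ).const_mul lam).exp
    refine (h1.mul (hW.hasDerivAt_setIntegral_mul h₁ h₂ m n α β hτ)).congr_deriv ?_
    rw [← hlam]
    ring
  have hconst : ∀ τ ∈ Ioi (0 : ℝ), exp (lam * τ) * I τ = exp (lam * t) * I t := fun τ hτ =>
    isOpen_Ioi.is_const_of_deriv_eq_zero isPreconnected_Ioi
      (fun y hy => (hd y hy).differentiableAt.differentiableWithinAt)
      (fun y hy => (hd y hy).deriv) hτ ht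
  have hlim : Tendsto (fun τ => exp (lam * τ) * I τ) (𝓝[>] 0) (𝓝 0) := by
    have h1 : Tendsto (fun τ => exp (lam * τ)) (𝓝[>] 0) (𝓝 (exp (lam * 0))) :=
      ((by fun_prop : Continuous fun τ => exp (lam * τ)).tendsto 0).mono_left nhdsWithin_le_nhds
    simpa using h1.mul h
  have h0 : exp (lam * t) * I t = 0 := by
    refine tendsto_nhds_unique (tendsto_const_nhds.congr' ?_) hlim
    filter_upwards [self_mem_nhdsWithin] with τ hτ using (hconst τ hτ).symm
  exact (mul_eq_zero.1 h0).resolve_left (exp_ne_zero _)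

/-- One-variable Fourier uniqueness is applied twice: first in the second coordinate, to the partial
coefficients `hvert`, then in the first coordinate. -/
theorem eq_zero (hW : IsTorusHeat L₁ L₂ W) (h₁ : 0 < L₁) (h₂ : 0 < L₂)
    (h : ∀ (m n : ℤ) (α β : ℝ), Tendsto
      (fun τ => ∫ z in Icc 0 L₁ ×ˢ Icc 0 L₂, W τ z * torusMode L₁ L₂ m n α β z) (𝓝[>] 0) (𝓝 0))
    {t : ℝ} (ht : 0 < t) (z : ℝ × ℝ) : W t z = 0 := by
  have hc : Continuous (W t) := (contDiff_slice hW.smooth ht).continuous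
  have hvert : ∀ (m : ℤ) (α c : ℝ),
      ∫ a in 0..L₁, W t (a, c) * cos (2 * π / L₁ * m * a + α) = 0 := by
    intro m α
    refine periodic_eq_zero_of_integral_mul_cos_eq_zero h₂ ?_
      (fun c => by simp only [hW.periodic_snd t ht]) fun n β => ?_
    · exact intervalIntegral.continuous_parametric_intervalIntegral_of_continuous'
        (f := fun c a => W t (a, c) * cos (2 * π / L₁ * m * a + α)) (by fun_prop) 0 L₁
    · have h0 := hW.setIntegral_mul_eq_zero h₁ h₂ m n α β (h m n α β) ht
      rw [setIntegral_Icc_prod_Icc_symm (hc.fun_mul (continuous_torusMode ..)) h₁.le h₂.le] at h0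
      refine Eq.trans (intervalIntegral.integral_congr fun c _ => ?_) h0
      simp only [torusMode, ← mul_assoc]
      rw [intervalIntegral.integral_mul_const]
  exact periodic_eq_zero_of_integral_mul_cos_eq_zero h₁ (g := fun a => W t (a, z.2))
    (by fun_prop) (fun a => hW.periodic_fst t ht a z.2) (fun m α => hvert m α z.2) z.1

end IsTorusHeat

/-! ### The Klein bottle in coordinates -/

namespace KleinBottle

variable {b : ℝ}

theorem proj_one_add (b a c : ℝ) : proj b !₂[1 + a, c] = proj b !₂[a, c] := by
  simpa using! (Quot.sound (KleinRel.translate (b := b) !₂[a, c])).symm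

theorem proj_glide (b a c : ℝ) : proj b !₂[1 - a, b + c] = proj b !₂[a, c] := by
  simpa using! (Quot.sound (KleinRel.glide (b := b) !₂[a, c])).symm

theorem proj_add_two_mul (b a c : ℝ) : proj b !₂[a, c + 2 * b] = proj b !₂[a, c] := by
  have h := proj_glide b (1 - a) (b + c)
  rw [sub_sub_cancel, show b + (b + c) = c + 2 * b by ring] at h
  exact h.trans (proj_glide b a c)

theorem plane_eta (p : Plane) : !₂[p 0, p 1] = p := by
  ext i
  fin_cases i <;> rfl

theorem exists_proj_eq (x : KleinBottle b) : ∃ a c, proj b !₂[a, c] = x := by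
  obtain ⟨p, rfl⟩ := Quot.exists_rep x
  exact ⟨p 0, p 1, by rw [plane_eta]; rfl⟩

theorem contDiff_plane_mk {n : WithTop ℕ∞} :
    ContDiff ℝ n fun z : ℝ × ℝ => (!₂[z.1, z.2] : Plane) := by
  rw [contDiff_euclidean]
  intro i
  fin_cases i
  · exact contDiff_fst
  · exact contDiff_snd

theorem continuous_plane_mk : Continuous fun z : ℝ × ℝ => (!₂[z.1, z.2] : Plane) :=
  (contDiff_plane_mk (n := 0)).continuous

theorem continuous_proj (b : ℝ) : Continuous (proj b) := continuous_quot_mk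

theorem continuous_proj_mk (b : ℝ) : Continuous fun z : ℝ × ℝ => proj b !₂[z.1, z.2] :=
  (continuous_proj b).comp continuous_plane_mk

/-- A function on the plane that is invariant under the gluing, as a function on the quotient. -/
def descend (F : ℝ × ℝ → ℝ) (h₁ : ∀ a c, F (1 + a, c) = F (a, c))
    (h₂ : ∀ a c, F (1 - a, b + c) = F (a, c)) : KleinBottle b → ℝ :=
  Quot.lift (fun p : Plane => F (p 0, p 1)) fun p q hpq => by
    cases hpq with
    | translate => simpa using (h₁ _ _).symm
    | glide => simpa using (h₂ _ _).symm

theorem descend_proj (F : ℝ × ℝ → ℝ) (h₁ : ∀ a c, F (1 + a, c) = F (a, c))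
    (h₂ : ∀ a c, F (1 - a, b + c) = F (a, c)) (p : Plane) :
    descend F h₁ h₂ (proj b p) = F (p 0, p 1) := rfl

theorem continuous_descend {F : ℝ × ℝ → ℝ} (hF : Continuous F)
    (h₁ : ∀ a c, F (1 + a, c) = F (a, c)) (h₂ : ∀ a c, F (1 - a, b + c) = F (a, c)) :
    Continuous (descend F h₁ h₂) :=
  continuous_coinduced_dom.2 (by
    show Continuous fun p : Plane => F (p 0, p 1)
    fun_prop)

theorem integral_vol {g : KleinBottle b → ℝ}
    (hg : Continuous fun z : ℝ × ℝ => g (proj b !₂[z.1, z.2])) :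
    ∫ y, g y ∂(vol b) = ∫ z in Icc 0 1 ×ˢ Icc 0 b, g (proj b !₂[z.1, z.2]) := by
  have hproj : Measurable (proj b) := fun s hs => hs
  have hgp : Measurable (g ∘ proj b) := by
    have : g ∘ proj b = (fun z : ℝ × ℝ => g (proj b !₂[z.1, z.2])) ∘ fun p : Plane => (p 0, p 1) := by
      ext p
      simp only [Function.comp, plane_eta]
    rw [this]
    exact (hg.comp (by fun_prop)).measurable
  -- The σ-algebra is the quotient one, so measurability may be tested after `proj`.
  have hgm : Measurable g := fun s hs => hgp hs
  rw [vol, integral_map hproj.aemeasurable hgm.stronglyMeasurable.aestronglyMeasurable]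
  have e₁ := EuclideanSpace.volume_preserving_symm_measurableEquiv_toLp (Fin 2)
  have e₂ := volume_preserving_finTwoArrow ℝ
  have key := (e₂.comp e₁).setIntegral_preimage_emb
    ((MeasurableEquiv.finTwoArrow (α := ℝ)).measurableEmbedding.comp
      (MeasurableEquiv.toLp 2 (Fin 2 → ℝ)).symm.measurableEmbedding)
    (fun z : ℝ × ℝ => g (proj b !₂[z.1, z.2])) (Ico 0 1 ×ˢ Ico 0 b)
  have hae : (Ico (0 : ℝ) 1 ×ˢ Ico (0 : ℝ) b : Set (ℝ × ℝ)) =ᵐ[volume] Icc 0 1 ×ˢ Icc 0 b := by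
    rw [Measure.volume_eq_prod]
    exact Measure.set_prod_ae_eq Ico_ae_eq_Icc Ico_ae_eq_Icc
  rw [setIntegral_congr_set hae] at key
  rw [← key]
  refine setIntegral_congr_fun ?_ fun p _ => ?_
  · exact (measurableSet_Ico.preimage (by fun_prop)).inter (measurableSet_Ico.preimage (by fun_prop))
  · show g (proj b p) = g (proj b !₂[p 0, p 1])
    rw [plane_eta]

/-- The glide reflection maps the lower half of the torus rectangle onto the upper half and
preserves area. -/
theorem setIntegral_fold {Φ : ℝ × ℝ → ℝ} (hΦ : Continuous Φ) (hb : 0 < b) :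
    ∫ z in Icc 0 1 ×ˢ Icc 0 (2 * b), Φ z =
      ∫ z in Icc 0 1 ×ˢ Icc 0 b, (Φ z + Φ (1 - z.1, b + z.2)) := by
  set J : ℝ → ℝ := fun c => ∫ a in 0..1, Φ (a, c) with hJ
  have hJc : Continuous J := intervalIntegral.continuous_parametric_intervalIntegral_of_continuous'
    (f := fun c a => Φ (a, c)) (by fun_prop) 0 1
  have h2 : ∀ c, ∫ a in 0..1, Φ (1 - a, b + c) = J (b + c) := fun c => by
    simpa using intervalIntegral.integral_comp_sub_left (a := 0) (b := 1)
      (fun a => Φ (a, b + c)) (1 : ℝ)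
  rw [setIntegral_Icc_prod_Icc_symm hΦ zero_le_one (by positivity),
    setIntegral_Icc_prod_Icc_symm (by fun_prop) zero_le_one hb.le,
    ← intervalIntegral.integral_add_adjacent_intervals (hJc.intervalIntegrable 0 b)
      (hJc.intervalIntegrable b (2 * b))]
  have h3 : ∀ c, ∫ a in 0..1, (Φ (a, c) + Φ (1 - a, b + c)) = J c + J (b + c) := fun c => by
    rw [intervalIntegral.integral_add (Continuous.intervalIntegrable (by fun_prop) _ _)
      (Continuous.intervalIntegrable (by fun_prop) _ _), h2]
  simp only [h3]
  rw [intervalIntegral.integral_add (Continuous.intervalIntegrable (by fun_prop) _ _)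
      (Continuous.intervalIntegrable (by fun_prop) _ _),
    intervalIntegral.integral_comp_add_left]
  ring_nf

theorem laplacian_eq_planarLaplacian {f : Plane → ℝ} (hf : ContDiff ℝ 2 f) (p : Plane) :
    Laplacian.laplacian f p = planarLaplacian (fun z => f !₂[z.1, z.2]) (p 0, p 1) := by
  have hd : ∀ q, HasFDerivAt f (fderiv ℝ f q) q := fun q =>
    (hf.differentiable two_ne_zero q).hasFDerivAt
  have hd2 : ∀ q, HasFDerivAt (fderiv ℝ f) (fderiv ℝ (fderiv ℝ f) q) q := fun q =>
    ((hf.fderiv_right (m := 1) le_rfl).differentiable one_ne_zero q).hasFDerivAt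
  -- Along a line of velocity `v`, the second derivative is the second Fréchet derivative evaluated
  -- at `(v, v)`.
  have key : ∀ (l : ℝ → Plane) (v : Plane), (∀ s, HasDerivAt l v s) → ∀ s,
      deriv (deriv fun s => f (l s)) s = fderiv ℝ (fderiv ℝ f) (l s) v v := by
    intro l v hl s
    have e : (deriv fun s => f (l s)) = fun s => fderiv ℝ f (l s) v := funext fun s =>
      ((hd (l s)).comp_hasDerivAt s (hl s)).deriv
    rw [e]
    exact (((hd2 (l s)).comp_hasDerivAt s (hl s)).clm_apply (hasDerivAt_const s v)).deriv.trans
      (by simp)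
  have hl₁ : ∀ c s, HasDerivAt (fun s => (!₂[s, c] : Plane)) (EuclideanSpace.single 0 1) s := by
    intro c s
    have e : (fun s => (!₂[s, c] : Plane)) =
        fun s => !₂[0, c] + s • EuclideanSpace.single 0 1 := by
      ext s i
      fin_cases i <;> simp
    rw [e]
    simpa using ((hasDerivAt_id s).smul_const (EuclideanSpace.single 0 1 : Plane)).const_add !₂[0, c]
  have hl₂ : ∀ a s, HasDerivAt (fun s => (!₂[a, s] : Plane)) (EuclideanSpace.single 1 1) s := by
    intro a s
    have e : (fun s => (!₂[a, s] : Plane)) =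
        fun s => !₂[a, 0] + s • EuclideanSpace.single 1 1 := by
      ext s i
      fin_cases i <;> simp
    rw [e]
    simpa using ((hasDerivAt_id s).smul_const (EuclideanSpace.single 1 1 : Plane)).const_add !₂[a, 0]
  rw [InnerProductSpace.laplacian_eq_iteratedFDeriv_orthonormalBasis f
    (EuclideanSpace.basisFun (Fin 2) ℝ)]
  simp only [planarLaplacian]
  rw [key _ _ (hl₁ (p 1)), key _ _ (hl₂ (p 0)), plane_eta]
  simp [iteratedFDeriv_two_apply]

end KleinBottle

/-! ### The heat kernel of the torus and its initial condition -/

theorem planarLaplacian_add {f g : ℝ × ℝ → ℝ} (hf : ContDiff ℝ 2 f) (hg : ContDiff ℝ 2 g)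
    (z : ℝ × ℝ) :
    planarLaplacian (fun z => f z + g z) z = planarLaplacian f z + planarLaplacian g z := by
  have h := planarLaplacian_sub (hf.add hg) hg z
  simp only [add_sub_cancel_right] at h
  linarith! [h]

theorem IsTorusHeat.add {L₁ L₂ : ℝ} {V W : ℝ → ℝ × ℝ → ℝ} (hW : IsTorusHeat L₁ L₂ W)
    (hV : IsTorusHeat L₁ L₂ V) : IsTorusHeat L₁ L₂ fun t z => W t z + V t z where
  smooth := hW.smooth.add hV.smooth
  heat t ht z := by
    rw [planarLaplacian_add (hW.contDiff_two ht) (hV.contDiff_two ht)]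
    exact (hW.heat t ht z).add (hV.heat t ht z)
  periodic_fst t ht a c := by rw [hW.periodic_fst t ht, hV.periodic_fst t ht]
  periodic_snd t ht a c := by rw [hW.periodic_snd t ht, hV.periodic_snd t ht]

/-- The heat kernel of the flat torus with periods `L₁`, `L₂`, read on the plane. -/
noncomputable def torusHeat (L₁ L₂ : ℝ) (x : ℝ × ℝ) (t : ℝ) (z : ℝ × ℝ) : ℝ :=
  circleHeat L₁ t (z.1 - x.1) * circleHeat L₂ t (z.2 - x.2)

section TorusHeat

variable {L₁ L₂ : ℝ}

theorem continuous_circleHeat {L : ℝ} (hL : 0 < L) {t : ℝ} (ht : 0 < t) :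
    Continuous (circleHeat L t) := (contDiff_circleHeat hL ht).continuous

theorem continuous_torusHeat (h₁ : 0 < L₁) (h₂ : 0 < L₂) (x : ℝ × ℝ) {t : ℝ} (ht : 0 < t) :
    Continuous (torusHeat L₁ L₂ x t) := by
  have := continuous_circleHeat h₁ ht
  have := continuous_circleHeat h₂ ht
  unfold torusHeat
  fun_prop

theorem isTorusHeat_torusHeat (h₁ : 0 < L₁) (h₂ : 0 < L₂) (x : ℝ × ℝ) :
    IsTorusHeat L₁ L₂ (torusHeat L₁ L₂ x) where
  smooth := by
    have s₁ := (contDiffOn_circleHeat h₁).comp (s := Ioi (0 : ℝ) ×ˢ (univ : Set (ℝ × ℝ)))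
      (f := fun z : ℝ × ℝ × ℝ => (z.1, z.2.1 - x.1)) (ContDiff.contDiffOn (by fun_prop))
      fun z hz => ⟨hz.1, mem_univ _⟩
    have s₂ := (contDiffOn_circleHeat h₂).comp (s := Ioi (0 : ℝ) ×ˢ (univ : Set (ℝ × ℝ)))
      (f := fun z : ℝ × ℝ × ℝ => (z.1, z.2.2 - x.2)) (ContDiff.contDiffOn (by fun_prop))
      fun z hz => ⟨hz.1, mem_univ _⟩
    exact s₁.mul s₂
  heat t ht z := by
    have key : ∀ {L : ℝ}, 0 < L → ∀ p k s : ℝ,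
        deriv (deriv fun y => circleHeat L t (y - p) * k) s =
          deriv (deriv (circleHeat L t)) (s - p) * k := by
      intro L hL p k s
      have e₁ : (deriv fun y => circleHeat L t (y - p) * k) =
          fun y => deriv (circleHeat L t) (y - p) * k := funext fun y => by
        rw [deriv_mul_const_field, deriv_comp_sub_const]
      rw [e₁, deriv_mul_const_field, deriv_comp_sub_const]
    refine ((hasDerivAt_circleHeat_time h₁ ht (z.1 - x.1)).mul
      (hasDerivAt_circleHeat_time h₂ ht (z.2 - x.2))).congr_deriv ?_
    simp only [planarLaplacian, torusHeat]
    rw [key h₁]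
    simp only [mul_comm (circleHeat L₁ t (z.1 - x.1))]
    rw [key h₂]
  periodic_fst t _ a c := by
    simp only [torusHeat]
    rw [add_sub_right_comm, circleHeat_periodic h₁]
  periodic_snd t _ a c := by
    simp only [torusHeat]
    rw [add_sub_right_comm, circleHeat_periodic h₂]

/-- On the compact part where `ε ≤ g`, the function `E` has no zero, so `g / E` is bounded there. -/
theorem IsCompact.exists_le_add_mul {X : Type*} [TopologicalSpace X] {K : Set X} (hK : IsCompact K)
    {g E : X → ℝ} (hg : Continuous g) (hE : Continuous E) (hE0 : ∀ z, 0 ≤ E z)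
    (h : ∀ z ∈ K, E z = 0 → g z ≤ 0) {ε : ℝ} (hε : 0 < ε) :
    ∃ C, 0 ≤ C ∧ ∀ z ∈ K, g z ≤ ε + C * E z := by
  have hK' : IsCompact (K ∩ {z | ε ≤ g z}) := hK.inter_right (isClosed_le continuous_const hg)
  have hpos : ∀ z ∈ K ∩ {z | ε ≤ g z}, E z ≠ 0 := fun z hz h0 =>
    (hε.trans_le hz.2).not_ge (h z hz.1 h0)
  obtain ⟨C, hC⟩ := hK'.exists_bound_of_continuousOn (hg.continuousOn.div hE.continuousOn hpos)
  refine ⟨max C 0, le_max_right _ _, fun z hz => ?_⟩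
  have hCE : 0 ≤ max C 0 * E z := mul_nonneg (le_max_right _ _) (hE0 z)
  by_cases hzε : ε ≤ g z
  · have h1 := (le_abs_self _).trans ((hC z ⟨hz, hzε⟩).trans (le_max_left C 0))
    have hEz := (hE0 z).lt_of_ne' (hpos z ⟨hz, hzε⟩)
    simp only [Pi.div_apply] at h1
    rw [div_le_iff₀ hEz] at h1
    linarith
  · linarith

/-- A Korovkin-type argument replaces Gaussian estimates: the kernel is nonnegative with mass one,
its integral against `E` tends to zero, and `|F - F x|` is at most `ε / 2 + C * E`. -/
theorem tendsto_setIntegral_torusHeat_mul (h₁ : 0 < L₁) (h₂ : 0 < L₂) {F : ℝ × ℝ → ℝ}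
    (hF : Continuous F) (hF₁ : ∀ a c, F (a + L₁, c) = F (a, c))
    (hF₂ : ∀ a c, F (a, c + L₂) = F (a, c)) (x : ℝ × ℝ) :
    Tendsto (fun t => ∫ z in Icc 0 L₁ ×ˢ Icc 0 L₂, torusHeat L₁ L₂ x t z * F z)
      (𝓝[>] 0) (𝓝 (F x)) := by
  set K : Set (ℝ × ℝ) := Icc 0 L₁ ×ˢ Icc 0 L₂ with hKdef
  have hK : IsCompact K := isCompact_Icc.prod isCompact_Icc
  let C₁ : ℝ → ℝ := fun a => cos (2 * π / L₁ * (a - x.1))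
  let C₂ : ℝ → ℝ := fun c => cos (2 * π / L₂ * (c - x.2))
  -- `E` vanishes exactly on the translates of `x` by the period lattice, where `F` takes the value
  -- `F x`.
  let E : ℝ × ℝ → ℝ := fun z => (1 - C₁ z.1) + (1 - C₂ z.2)
  have hC₁ : Continuous C₁ := by fun_prop
  have hC₂ : Continuous C₂ := by fun_prop
  have hE : Continuous E := by fun_prop
  have hC₁' : ∀ a, C₁ a ≤ 1 := fun a => cos_le_one _
  have hC₂' : ∀ c, C₂ c ≤ 1 := fun c => cos_le_one _
  have hE0 : ∀ z, 0 ≤ E z := fun z => by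
    have := hC₁' z.1
    have := hC₂' z.2
    simp only [E]
    linarith
  have hzero : ∀ z ∈ K, E z = 0 → |F z - F x| ≤ 0 := by
    intro z _ hz
    have a₁ : C₁ z.1 = 1 := by
      have := hC₁' z.1
      have := hC₂' z.2
      simp only [E] at hz
      linarith
    have a₂ : C₂ z.2 = 1 := by
      have := hC₁' z.1
      have := hC₂' z.2
      simp only [E] at hz
      linarith
    obtain ⟨m, hm⟩ := (cos_eq_one_iff _).1 a₁
    obtain ⟨n, hn⟩ := (cos_eq_one_iff _).1 a₂
    have z₁ : z.1 = x.1 + m * L₁ := by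
      have := pi_pos
      field_simp at hm
      linarith
    have z₂ : z.2 = x.2 + n * L₂ := by
      have := pi_pos
      field_simp at hn
      linarith
    have p₁ : F (x.1 + m * L₁, z.2) = F (x.1, z.2) :=
      Function.Periodic.int_mul (f := fun a => F (a, z.2)) (fun a => hF₁ a z.2) m x.1
    have p₂ : F (x.1, x.2 + n * L₂) = F (x.1, x.2) :=
      Function.Periodic.int_mul (f := fun c => F (x.1, c)) (fun c => hF₂ x.1 c) n x.2
    have : F z = F x := by
      rw [← z₁, z₂] at p₁
      calc F z = F (z.1, x.2 + n * L₂) := by rw [← z₂]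
        _ = _ := p₁.trans p₂
    simp [this]
  have hprod : ∀ {p q : ℝ → ℝ}, ∫ z in K, p z.1 * q z.2 =
      (∫ a in 0..L₁, p a) * ∫ c in 0..L₂, q c := by
    intro p q
    rw [hKdef, Measure.volume_eq_prod, setIntegral_prod_mul, integral_Icc_eq_integral_Ioc,
      integral_Icc_eq_integral_Ioc, intervalIntegral.integral_of_le h₁.le,
      intervalIntegral.integral_of_le h₂.le]
  have hT1 : ∀ t, 0 < t → ∫ z in K, torusHeat L₁ L₂ x t z = 1 := fun t ht => by
    simp only [torusHeat]
    rw [hprod (p := fun a => circleHeat L₁ t (a - x.1)) (q := fun c => circleHeat L₂ t (c - x.2)),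
      integral_circleHeat h₁ ht, integral_circleHeat h₂ ht, one_mul]
  have hTE : ∀ t, 0 < t → ∫ z in K, torusHeat L₁ L₂ x t z * E z =
      (1 - exp (-((2 * π / L₁) ^ 2 * t))) + (1 - exp (-((2 * π / L₂) ^ 2 * t))) := fun t ht => by
    have c₁ := continuous_circleHeat h₁ ht
    have c₂ := continuous_circleHeat h₂ ht
    have e : ∀ z : ℝ × ℝ, torusHeat L₁ L₂ x t z * E z = 2 * torusHeat L₁ L₂ x t z -
        (circleHeat L₁ t (z.1 - x.1) * C₁ z.1) * circleHeat L₂ t (z.2 - x.2) -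
        circleHeat L₁ t (z.1 - x.1) * (circleHeat L₂ t (z.2 - x.2) * C₂ z.2) := fun z => by
      simp only [torusHeat, E]
      ring
    simp only [e]
    rw [integral_sub, integral_sub, integral_const_mul, hT1 t ht,
      hprod (p := fun a => circleHeat L₁ t (a - x.1) * C₁ a)
        (q := fun c => circleHeat L₂ t (c - x.2)),
      hprod (p := fun a => circleHeat L₁ t (a - x.1))
        (q := fun c => circleHeat L₂ t (c - x.2) * C₂ c),
      integral_circleHeat h₁ ht, integral_circleHeat h₂ ht, integral_circleHeat_mul_cos h₁ ht,
      integral_circleHeat_mul_cos h₂ ht]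
    · ring
    all_goals
      have := continuous_torusHeat h₁ h₂ x ht
      exact (Continuous.continuousOn (by fun_prop)).integrableOn_compact hK
  rw [Metric.tendsto_nhds]
  intro ε hε
  obtain ⟨C, hC0, hC⟩ := hK.exists_le_add_mul (g := fun z => |F z - F x|) (by fun_prop) hE hE0 hzero
    (half_pos hε)
  have hsmall : Tendsto (fun t => C * ((1 - exp (-((2 * π / L₁) ^ 2 * t))) +
      (1 - exp (-((2 * π / L₂) ^ 2 * t))))) (𝓝[>] 0) (𝓝 0) := by
    have : Continuous fun t : ℝ => C * ((1 - exp (-((2 * π / L₁) ^ 2 * t))) +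
      (1 - exp (-((2 * π / L₂) ^ 2 * t)))) := by fun_prop
    simpa using (this.tendsto 0).mono_left nhdsWithin_le_nhds
  filter_upwards [self_mem_nhdsWithin, hsmall.eventually_lt_const (half_pos hε)] with t ht hlt
  have hTc := continuous_torusHeat h₁ h₂ x ht
  have hT0 : ∀ z, 0 ≤ torusHeat L₁ L₂ x t z := fun z =>
    mul_nonneg (circleHeat_nonneg h₁ ht _) (circleHeat_nonneg h₂ ht _)
  have hint : ∀ {G : ℝ × ℝ → ℝ}, Continuous G → IntegrableOn G K := fun hG =>
    hG.continuousOn.integrableOn_compact hK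
  have hdiff : (∫ z in K, torusHeat L₁ L₂ x t z * F z) - F x =
      ∫ z in K, torusHeat L₁ L₂ x t z * (F z - F x) := by
    simp only [mul_sub]
    rw [integral_sub (hint (by fun_prop)) (hint (by fun_prop)), integral_mul_const, hT1 t ht,
      one_mul]
  rw [Real.dist_eq, hdiff]
  calc |∫ z in K, torusHeat L₁ L₂ x t z * (F z - F x)|
      ≤ ∫ z in K, |torusHeat L₁ L₂ x t z * (F z - F x)| := abs_integral_le_integral_abs
    _ ≤ ∫ z in K, (torusHeat L₁ L₂ x t z * (ε / 2) + C * (torusHeat L₁ L₂ x t z * E z)) := by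
      refine setIntegral_mono_on (hint (by fun_prop)) (hint (by fun_prop)) hK.measurableSet
        fun z hz => ?_
      rw [abs_mul, abs_of_nonneg (hT0 z)]
      calc _ ≤ torusHeat L₁ L₂ x t z * (ε / 2 + C * E z) :=
            mul_le_mul_of_nonneg_left (hC z hz) (hT0 z)
        _ = _ := by ring
    _ = ε / 2 + C * ((1 - exp (-((2 * π / L₁) ^ 2 * t))) +
          (1 - exp (-((2 * π / L₂) ^ 2 * t)))) := by
      rw [integral_add (hint (by fun_prop)) (hint (by fun_prop)), integral_mul_const,
        integral_const_mul, hT1 t ht, hTE t ht, one_mul]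
    _ < ε := by linarith

end TorusHeat

/-! ### The heat kernel of the Klein bottle: uniqueness and existence -/

namespace KleinBottle

variable {b : ℝ}

/-- `u` is a smooth solution of the heat equation on the Klein bottle for positive times which
tends to the unit point mass at `x` as `t → 0+`. -/
structure IsHeatKernelAt (b : ℝ) (x : KleinBottle b) (u : ℝ → KleinBottle b → ℝ) : Prop where
  smooth : ContDiffOn ℝ (⊤ : ℕ∞) (fun z : ℝ × Plane => u z.1 (proj b z.2)) (Ioi 0 ×ˢ univ)
  heat_equation : ∀ t : ℝ, 0 < t → ∀ p : Plane,
    deriv (fun τ => u τ (proj b p)) t = Laplacian.laplacian (fun q => u t (proj b q)) p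
  initial_condition : ∀ f : KleinBottle b → ℝ, Continuous f →
    Tendsto (fun t => ∫ y, u t y * f y ∂(vol b)) (𝓝[>] 0) (𝓝 (f x))

theorem IsHeatKernel.isHeatKernelAt {K : ℝ → KleinBottle b → KleinBottle b → ℝ}
    (hK : IsHeatKernel b K) (x : KleinBottle b) : IsHeatKernelAt b x fun t => K t x :=
  ⟨hK.smooth x, hK.heat_equation x, hK.initial_condition x⟩

theorem contDiff_proj_slice {u : ℝ → KleinBottle b → ℝ}
    (hu : ContDiffOn ℝ (⊤ : ℕ∞) (fun z : ℝ × Plane => u z.1 (proj b z.2)) (Ioi 0 ×ˢ univ))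
    {t : ℝ} (ht : 0 < t) : ContDiff ℝ 2 fun q => u t (proj b q) :=
  (contDiffOn_univ.1 (hu.comp (f := fun q : Plane => (t, q)) (s := univ)
    (ContDiff.contDiffOn (by fun_prop)) fun q _ => ⟨ht, mem_univ _⟩)).of_le
      (WithTop.coe_le_coe.2 (le_top : (2 : ℕ∞) ≤ ⊤))

namespace IsHeatKernelAt

variable {x : KleinBottle b} {u v : ℝ → KleinBottle b → ℝ}

theorem isTorusHeat (hu : IsHeatKernelAt b x u) :
    IsTorusHeat 1 (2 * b) fun t z => u t (proj b !₂[z.1, z.2]) where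
  smooth := hu.smooth.comp (f := fun z : ℝ × ℝ × ℝ => (z.1, (!₂[z.2.1, z.2.2] : Plane)))
    (contDiff_fst.prodMk (contDiff_plane_mk.comp contDiff_snd)).contDiffOn
    fun z hz => ⟨hz.1, mem_univ _⟩
  heat t ht z := by
    have h := hu.heat_equation t ht !₂[z.1, z.2]
    rw [laplacian_eq_planarLaplacian (contDiff_proj_slice hu.smooth ht)] at h
    -- The equation is stated with `deriv`, which defaults to zero; smoothness supplies the actual
    -- differentiability in time.
    have hd : DifferentiableAt ℝ (fun z : ℝ × Plane => u z.1 (proj b z.2)) (t, !₂[z.1, z.2]) :=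
      (hu.smooth.contDiffAt ((isOpen_Ioi.prod isOpen_univ).mem_nhds
        (mk_mem_prod ht (mem_univ _)))).differentiableAt (by simp)
    have hd' : DifferentiableAt ℝ (fun τ => u τ (proj b !₂[z.1, z.2])) t :=
      hd.comp t (f := fun τ => (τ, (!₂[z.1, z.2] : Plane))) (by fun_prop)
    exact hd'.hasDerivAt.congr_deriv h
  periodic_fst t _ a c := by rw [add_comm, proj_one_add]
  periodic_snd t _ a c := by rw [proj_add_two_mul]

theorem continuous_mk (hu : IsHeatKernelAt b x u) {t : ℝ} (ht : 0 < t) :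
    Continuous fun z : ℝ × ℝ => u t (proj b !₂[z.1, z.2]) :=
  (hu.isTorusHeat.contDiff_two ht).continuous

/-- A solution of the heat equation for positive times is determined by its initial point mass. -/
theorem unique (hb : 0 < b) (hu : IsHeatKernelAt b x u) (hv : IsHeatKernelAt b x v) {t : ℝ}
    (ht : 0 < t) (y : KleinBottle b) : u t y = v t y := by
  have h2b : 0 < 2 * b := by positivity
  have hW := hu.isTorusHeat.sub hv.isTorusHeat
  obtain ⟨a, c, rfl⟩ := exists_proj_eq y
  refine sub_eq_zero.1 (hW.eq_zero one_pos h2b (fun m n α β => ?_) ht (a, c))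
  set φ := torusMode 1 (2 * b) m n α β with hφdef
  have hφ : Continuous φ := continuous_torusMode ..
  have hφ₁ : ∀ a c, φ (a + 1, c) = φ (a, c) := torusMode_add_fst one_ne_zero _ m n α β
  have hφ₂ : ∀ a c, φ (a, c + 2 * b) = φ (a, c) := torusMode_add_snd _ h2b.ne' m n α β
  -- A torus mode need not descend, but its sum with its glide image does. By folding, pairing a
  -- lifted kernel with `φ` over the torus equals pairing the kernel with `f` over the Klein bottle,
  -- so both kernels have the same limit `f x`.
  let F : ℝ × ℝ → ℝ := fun z => φ z + φ (1 - z.1, b + z.2)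
  have hF : Continuous F := by fun_prop
  have hF₁ : ∀ a c, F (1 + a, c) = F (a, c) := fun a c => by
    simp only [F]
    rw [add_comm 1 a, hφ₁, ← hφ₁ (1 - (a + 1)), show 1 - (a + 1) + 1 = 1 - a by ring]
  have hF₂ : ∀ a c, F (1 - a, b + c) = F (a, c) := fun a c => by
    simp only [F]
    rw [sub_sub_cancel, show b + (b + c) = c + 2 * b by ring, hφ₂, add_comm]
  let f : KleinBottle b → ℝ := descend F hF₁ hF₂
  have hf : Continuous f := continuous_descend hF hF₁ hF₂
  have hfF : ∀ z : ℝ × ℝ, f (proj b !₂[z.1, z.2]) = F z := fun z => by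
    simp [f, descend_proj]
  have hpair : ∀ {w : ℝ → KleinBottle b → ℝ}, IsHeatKernelAt b x w → ∀ τ, 0 < τ →
      ∫ y, w τ y * f y ∂(vol b) =
        ∫ z in Icc 0 1 ×ˢ Icc 0 (2 * b), w τ (proj b !₂[z.1, z.2]) * φ z := by
    intro w hw τ hτ
    have hwc := hw.continuous_mk hτ
    rw [integral_vol (g := fun y => w τ y * f y) (by simp only [hfF]; exact hwc.fun_mul hF),
      setIntegral_fold (hwc.fun_mul hφ) hb]
    simp only [hfF, proj_glide, F, mul_add]
  have hlim := (hu.initial_condition f hf).sub (hv.initial_condition f hf)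
  rw [sub_self] at hlim
  refine hlim.congr' ?_
  filter_upwards [self_mem_nhdsWithin] with τ hτ
  have hK : IsCompact (Icc (0 : ℝ) 1 ×ˢ Icc 0 (2 * b)) := isCompact_Icc.prod isCompact_Icc
  rw [hpair hu τ hτ, hpair hv τ hτ, ← integral_sub]
  · simp only [sub_mul]
  · exact ((hu.continuous_mk hτ).fun_mul hφ).continuousOn.integrableOn_compact hK
  · exact ((hv.continuous_mk hτ).fun_mul hφ).continuousOn.integrableOn_compact hK

end IsHeatKernelAt

/-- The heat kernel of the Klein bottle, read on the plane: the sum of the torus heat kernels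
centred at `x` and at its image under the glide reflection. -/
noncomputable def kleinHeat (b : ℝ) (x : ℝ × ℝ) (t : ℝ) (z : ℝ × ℝ) : ℝ :=
  torusHeat 1 (2 * b) x t z + torusHeat 1 (2 * b) (1 - x.1, b + x.2) t z

/-- Gliding the argument amounts to gliding the centre, by evenness in the first coordinate and
periodicity `2 * b` in the second. -/
theorem torusHeat_glide (hb : 0 < b) (x : ℝ × ℝ) (t a c : ℝ) :
    torusHeat 1 (2 * b) x t (1 - a, b + c) = torusHeat 1 (2 * b) (1 - x.1, b + x.2) t (a, c) := by
  simp only [torusHeat]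
  congr 1
  · rw [← circleHeat_neg]
    ring_nf
  · rw [← circleHeat_periodic (by positivity : 0 < 2 * b) t (c - (b + x.2))]
    ring_nf

theorem kleinHeat_one_add (b : ℝ) (x : ℝ × ℝ) (t a c : ℝ) :
    kleinHeat b x t (1 + a, c) = kleinHeat b x t (a, c) := by
  simp only [kleinHeat, torusHeat]
  rw [add_comm 1 a, add_sub_right_comm, circleHeat_periodic one_pos, add_sub_right_comm,
    circleHeat_periodic one_pos]

theorem kleinHeat_glide (hb : 0 < b) (x : ℝ × ℝ) (t a c : ℝ) :
    kleinHeat b x t (1 - a, b + c) = kleinHeat b x t (a, c) := by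
  simp only [kleinHeat]
  rw [torusHeat_glide hb, ← torusHeat_glide hb x t (1 - a) (b + c), add_comm, sub_sub_cancel]
  congr 1
  simp only [torusHeat]
  rw [show b + (b + c) - x.2 = c - x.2 + 2 * b by ring, circleHeat_periodic (by positivity)]

theorem isTorusHeat_kleinHeat (hb : 0 < b) (x : ℝ × ℝ) : IsTorusHeat 1 (2 * b) (kleinHeat b x) :=
  (isTorusHeat_torusHeat one_pos (by positivity) x).add
    (isTorusHeat_torusHeat one_pos (by positivity) _)

/-- For the initial condition, folding turns the pairing of `kleinHeat` over the Klein bottle into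
that of a single torus kernel with the lift of `f`. -/
theorem isHeatKernelAt_descend (hb : 0 < b) (x : ℝ × ℝ) :
    IsHeatKernelAt b (proj b !₂[x.1, x.2]) fun t =>
      descend (kleinHeat b x t) (kleinHeat_one_add b x t) (kleinHeat_glide hb x t) := by
  have hT := isTorusHeat_kleinHeat hb x
  have hsmooth : ContDiffOn ℝ (⊤ : ℕ∞) (fun z : ℝ × Plane =>
      descend (kleinHeat b x z.1) (kleinHeat_one_add b x z.1) (kleinHeat_glide hb x z.1)
        (proj b z.2)) (Ioi 0 ×ˢ univ) := by
    simp only [descend_proj]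
    exact hT.smooth.comp (f := fun z : ℝ × Plane => (z.1, z.2 0, z.2 1))
      (ContDiff.contDiffOn (by fun_prop)) fun z hz => ⟨hz.1, mem_univ _⟩
  refine ⟨hsmooth, fun t ht p => ?_, fun f hf => ?_⟩
  · rw [laplacian_eq_planarLaplacian (contDiff_proj_slice (u := fun t =>
      descend (kleinHeat b x t) (kleinHeat_one_add b x t) (kleinHeat_glide hb x t)) hsmooth ht)]
    simp only [descend_proj]
    exact (hT.heat t ht _).deriv
  · have hF : Continuous fun z : ℝ × ℝ => f (proj b !₂[z.1, z.2]) := hf.comp (continuous_proj_mk b)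
    have h2b : 0 < 2 * b := by positivity
    refine (tendsto_setIntegral_torusHeat_mul one_pos h2b hF
      (fun a c => by simp only [add_comm a, proj_one_add])
      (fun a c => by simp only [proj_add_two_mul]) x).congr' ?_
    filter_upwards [self_mem_nhdsWithin] with t ht
    have hTc := continuous_torusHeat one_pos h2b x ht
    have hkc := (hT.contDiff_two ht).continuous
    rw [integral_vol (by simp only [descend_proj]; exact hkc.fun_mul hF),
      setIntegral_fold (hTc.fun_mul hF) hb]
    simp only [descend_proj, proj_glide, torusHeat_glide hb, ← add_mul]
    rfl

theorem exists_isHeatKernel (hb : 0 < b) :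
    ∃ K : ℝ → KleinBottle b → KleinBottle b → ℝ, IsHeatKernel b K := by
  choose a c hac using exists_proj_eq (b := b)
  refine ⟨fun t x => descend (kleinHeat b (a x, c x) t) (kleinHeat_one_add b _ t)
    (kleinHeat_glide hb _ t), ?_, ?_, ?_⟩ <;> intro x
  · exact (isHeatKernelAt_descend hb (a x, c x)).smooth
  · exact (isHeatKernelAt_descend hb (a x, c x)).heat_equation
  · simpa only [hac] using (isHeatKernelAt_descend hb (a x, c x)).initial_condition

/-! ### Failure of monotonicity for large time -/

theorem tendsto_exp_mul_kleinHeat_sub (hb : 0 < b) :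
    Tendsto (fun t => exp ((2 * π) ^ 2 * t) *
      (kleinHeat b (1 / 6, 0) t (0, 0) - kleinHeat b (1 / 6, 0) t (1 / 6, 0))) atTop
      (𝓝 (1 / (2 * b))) := by
  have h2b : 0 < 2 * b := by positivity
  -- The two centres are `(1/6, 0)` and `(5/6, b)`. Modulo 1, the horizontal distances to `(0, 0)`
  -- and `(1/6, 0)` are `1/6` and `0` from the first, `1/6` and `1/3` from the second. The first
  -- contributes `-1 / (2 * b)` to the limit, the second `2 / (2 * b)`.
  have l₁ := tendsto_exp_mul_circleHeat_sub one_pos (1 / 6) 0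
  have l₂ := tendsto_exp_mul_circleHeat_sub one_pos (1 / 6) (1 / 3)
  have m₁ := tendsto_circleHeat_atTop h2b 0
  have m₂ := tendsto_circleHeat_atTop h2b b
  have key := (l₁.mul m₁).add (l₂.mul m₂)
  have e₁ : cos (2 * π / 1 * (1 / 6)) = 1 / 2 := by
    rw [show 2 * π / 1 * (1 / 6) = π / 3 by ring, cos_pi_div_three]
  have e₂ : cos (2 * π / 1 * (1 / 3)) = -(1 / 2) := by
    rw [show 2 * π / 1 * (1 / 3) = π - π / 3 by ring, cos_pi_sub, cos_pi_div_three]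
  have e₃ : 2 / 1 * (1 / 2 - cos (2 * π / 1 * 0)) * (1 / (2 * b)) +
      2 / 1 * (1 / 2 - -(1 / 2)) * (1 / (2 * b)) = 1 / (2 * b) := by
    rw [mul_zero, cos_zero]
    ring
  rw [e₁, e₂, e₃] at key
  refine key.congr fun t => ?_
  have c₁ : circleHeat 1 t (-(1 / 6)) = circleHeat 1 t (1 / 6) := circleHeat_neg _ _
  have c₂ : circleHeat 1 t (-(5 / 6)) = circleHeat 1 t (1 / 6) := by
    rw [← circleHeat_periodic one_pos]; norm_num
  have c₃ : circleHeat 1 t (-(2 / 3)) = circleHeat 1 t (1 / 3) := by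
    rw [← circleHeat_periodic one_pos]; norm_num
  have c₄ : circleHeat (2 * b) t (-b) = circleHeat (2 * b) t b := circleHeat_neg _ _
  simp only [kleinHeat, torusHeat]
  norm_num
  norm_num at c₁ c₂ c₃
  rw [c₁, c₂, c₃, c₄]
  ring

/-- The horizontal segment from `(1/6, 0)` to `(0, 0)` is a minimal geodesic. -/
theorem isMinimalGeodesic_horizontal (b : ℝ) :
    IsMinimalGeodesic (fun s => proj b !₂[1 / 6 - s, 0]) (1 / 6) := by
  refine ⟨by norm_num, !₂[1 / 6, 0], !₂[-1, 0], fun s _ => ?_, ?_⟩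
  · refine congrArg (proj b) ?_
    ext i
    fin_cases i <;> simp [sub_eq_add_neg]
  · have hnorm : ‖(!₂[-1, 0] : Plane)‖ = 1 := by simp [EuclideanSpace.norm_eq]
    rw [hnorm, mul_one, gdist]
    symm
    apply IsLeast.csInf_eq
    refine ⟨⟨!₂[1 / 6, 0], !₂[0, 0], by simp, by simp, ?_⟩, ?_⟩
    · rw [EuclideanSpace.dist_eq]
      norm_num [Real.dist_eq]
    · rintro r ⟨p, q, hp, hq, rfl⟩
      -- The function `cos (2 * π * x₁)` descends, so it takes the values `1/2` and `1` at all lifts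
      -- of the two endpoints. Hence `cos (2 * π * (p 0 - q 0)) = 1/2`, which is impossible if `|p 0
      -- - q 0| < 1/6`.
      let C : KleinBottle b → ℝ := descend (fun z => cos (2 * π * z.1))
        (fun a c => by simp only [mul_add, mul_one, add_comm (2 * π), cos_add_two_pi])
        (fun a c => by simp only [mul_sub, mul_one, cos_two_pi_sub])
      have hCp : cos (2 * π * p 0) = 1 / 2 := by
        have h : C (proj b p) = C (proj b !₂[1 / 6 - 0, 0]) := by rw [hp]
        simp only [C, descend_proj] at h
        rw [h, ← cos_pi_div_three]
        congr 1
        simp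
        ring
      have hCq : cos (2 * π * q 0) = 1 := by
        have h : C (proj b q) = C (proj b !₂[1 / 6 - 1 / 6, 0]) := by rw [hq]
        simp only [C, descend_proj] at h
        rw [h]
        simp
      have hS : sin (2 * π * q 0) = 0 := by
        have := sin_sq_add_cos_sq (2 * π * q 0)
        rw [hCq] at this
        nlinarith
      have hdiff : cos (2 * π * (p 0 - q 0)) = 1 / 2 := by
        rw [mul_sub, cos_sub, hCq, hS, hCp]
        ring
      have hle : |p 0 - q 0| ≤ dist p q := by
        rw [dist_eq_norm]
        exact PiLp.norm_apply_le (p - q) 0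
      refine le_trans ?_ hle
      by_contra! hlt
      have hpi := pi_pos
      have : cos (π / 3) < cos |2 * π * (p 0 - q 0)| := by
        refine cos_lt_cos_of_nonneg_of_le_pi (abs_nonneg _) (by linarith) ?_
        rw [abs_mul, abs_of_pos (by positivity : 0 < 2 * π)]
        nlinarith
      rw [cos_abs, hdiff, cos_pi_div_three] at this
      exact lt_irrefl _ this

theorem IsHeatKernel.exists_forall_not_geodesicallyDecreasing (hb : 0 < b)
    {K : ℝ → KleinBottle b → KleinBottle b → ℝ} (hK : IsHeatKernel b K) :
    ∃ T : ℝ, 0 < T ∧ ∀ t : ℝ, T ≤ t → ¬ GeodesicallyDecreasing (K t) := by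
  have hpos : (0 : ℝ) < 1 / (2 * b) := by positivity
  obtain ⟨T, hT⟩ := eventually_atTop.1
    ((tendsto_exp_mul_kleinHeat_sub hb).eventually_const_lt hpos)
  refine ⟨max T 1, by positivity, fun t ht hdec => ?_⟩
  have ht0 : 0 < t := one_pos.trans_le ((le_max_right _ _).trans ht)
  have hlt := pos_of_mul_pos_right (hT t ((le_max_left _ _).trans ht)) (exp_pos _).le
  have heq : ∀ a c, K t (proj b !₂[1 / 6, 0]) (proj b !₂[a, c]) =
      kleinHeat b (1 / 6, 0) t (a, c) := fun a c =>
    (hK.isHeatKernelAt _).unique hb (isHeatKernelAt_descend hb (1 / 6, 0)) ht0 _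
  -- Monotonicity is tested only between the two ends of the segment.
  have hanti := hdec (proj b !₂[1 / 6, 0]) (1 / 6) _ (isMinimalGeodesic_horizontal b) (by simp)
    (a := 0) (by norm_num) (b := 1 / 6) (by norm_num) (by norm_num)
  simp only [heq, sub_self, sub_zero] at hanti
  linarith

end KleinBottle

theorem mainTheorem5 (b : ℝ) (hb : 0 < b) :
    (∃ K : ℝ → KleinBottle b → KleinBottle b → ℝ, KleinBottle.IsHeatKernel b K) ∧
    ∀ K : ℝ → KleinBottle b → KleinBottle b → ℝ, KleinBottle.IsHeatKernel b K →
      ∃ T : ℝ, 0 < T ∧ ∀ t : ℝ, T ≤ t → ¬ KleinBottle.GeodesicallyDecreasing (K t) :=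
  ⟨KleinBottle.exists_isHeatKernel hb,
    fun _ hK => hK.exists_forall_not_geodesicallyDecreasing hb⟩
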